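/- For a positive integer $m$ put $\zeta_m = e^{2\pi i/m}$ and $\mathbb{Q}_m = \mathbb{Q}(\zeta_m)$. A cyclotomic integer is an algebraic integer $\alpha \in \mathbb{C}$ that can be written as a sum of (not necessarily distinct) complex roots of unity. Its length is the smallest number of terms in such a representation, and its conductor $c(\alpha)$ is the smallest positive integer $n$ with $\mathbb{Q}(\alpha) \subseteq \mathbb{Q}_n$. Theorem. Let $\alpha$ be a cyclotomic integer of length $3$. Then $$[\mathbb{Q}_{c(\alpha)} : \mathbb{Q}(\alpha)] \le 4,$$ with equality if and only if $\alpha$ is of the form $$\alpha = \varepsilon\,(\zeta_6^{c} + \zeta_5^{a} + \zeta_5^{4a}),$$ where $c$ is an integer coprime to $6$, $a$ is an integer coprime to $5$, and $\varepsilon$ is a root of unity whose order is a multiple of $4$ and is divisible by neither $3$ nor $5$. -/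

import Mathlib

/-- `α` is a sum of `k` (not necessarily distinct) complex roots of unity. -/
def IsSumOfRootsOfUnity (k : ℕ) (α : ℂ) : Prop :=
  ∃ e : Fin k → ℂ, (∀ i, IsOfFinOrder (e i)) ∧ ∑ i, e i = α

/-- A cyclotomic integer: an algebraic integer that is a sum of complex roots of unity. -/
def IsCyclotomicInteger (α : ℂ) : Prop :=
  IsIntegral ℤ α ∧ ∃ k : ℕ, IsSumOfRootsOfUnity k α

/-- The length of a cyclotomic integer: the least number of roots of unity with sum `α`. -/
noncomputable def cyclotomicLength (α : ℂ) : ℕ :=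
  sInf {k : ℕ | IsSumOfRootsOfUnity k α}

/-- The root of unity `ζ_m = e^{2πi/m}`. -/
noncomputable def zetaRoot (m : ℕ) : ℂ :=
  Complex.exp (2 * (Real.pi : ℂ) * Complex.I / (m : ℂ))

/-- The cyclotomic field `ℚ_n = ℚ(ζ_n)`, as a subfield of `ℂ` (for `n ≥ 1`). -/
noncomputable def cycField (n : ℕ) : IntermediateField ℚ ℂ :=
  IntermediateField.adjoin ℚ {zetaRoot n}

/-- The conductor of `α`: the least positive integer `n` such that `ℚ(α) ⊆ ℚ_n`. -/
noncomputable def cycConductor (α : ℂ) : ℕ :=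
  sInf {n : ℕ | 0 < n ∧ IntermediateField.adjoin ℚ {α} ≤ cycField n}

open IntermediateField

/-! Write α as a sum of three roots of unity, the fewest possible. The terms of a shortest
representation lie in every ℚ_n that contains α, so they generate ℚ_{c(α)}. Hence an element of the
group G of ℚ_{c(α)} over ℚ(α) is determined by its action on the three terms, and it carries them to
another representation of α.

Two representations with a common term agree up to order (`range_subset_of_common_term`). Otherwise
their difference is a vanishing sum of six roots of unity with no proper vanishing subsum, and up to
rotation the only one is -ω - ω² + ζ₅ + ζ₅² + ζ₅³ + ζ₅⁴ (`exists_golden_of_minimal_vanishing`). Both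
this and the first fact come from averaging over the automorphisms x ↦ x^(1 + jM) of ℚ_{pM}.

If all of G permutes the terms, G is an abelian subgroup of S₃ and has order at most 3. Otherwise
the terms are -εω and two numbers εζ with ζ ≠ 1 and ζ⁵ = 1. The orbit of -εω lies in {-εω, εω²} and
its stabilizer can at most swap the other two terms, so |G| ≤ 4. Order 4 provides a swap σ, with ε ↦
ε and ζ ↦ ζ⁻¹, and a τ with ε ↦ -ε and ω ↦ ω²; these force the conditions on the order of ε.
Conversely, under these conditions the Chinese remainder theorem gives an element of order 4 in G.
-/

/-! ### Cyclotomic fields and their automorphisms -/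

theorem zetaRoot_isPrimitiveRoot {n : ℕ} (hn : 0 < n) : IsPrimitiveRoot (zetaRoot n) n :=
  Complex.isPrimitiveRoot_exp n hn.ne'

theorem mem_cycField_of_pow_eq_one {n : ℕ} (hn : 0 < n) {x : ℂ} (hx : x ^ n = 1) :
    x ∈ cycField n := by
  have : NeZero n := ⟨hn.ne'⟩
  obtain ⟨i, -, rfl⟩ := (zetaRoot_isPrimitiveRoot hn).eq_pow_of_pow_eq_one hx
  exact pow_mem (mem_adjoin_simple_self ℚ _) i

theorem cycField_le_iff {n : ℕ} {K : IntermediateField ℚ ℂ} : cycField n ≤ K ↔ zetaRoot n ∈ K :=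
  adjoin_simple_le_iff

theorem cycField_mono {n m : ℕ} (hm : 0 < m) (h : n ∣ m) : cycField n ≤ cycField m := by
  have hn : 0 < n := Nat.pos_of_dvd_of_pos h hm
  refine cycField_le_iff.2 (mem_cycField_of_pow_eq_one hm ?_)
  obtain ⟨k, rfl⟩ := h
  rw [pow_mul, (zetaRoot_isPrimitiveRoot hn).pow_eq_one, one_pow]

theorem mem_cycField_of_pow_two_mul_eq_one {n : ℕ} (hn : Odd n) {x : ℂ} (hx : x ^ (2 * n) = 1) :
    x ∈ cycField n := by
  have h : x ^ n = 1 ∨ x ^ n = -1 := by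
    rw [mul_comm, pow_mul] at hx
    simpa using hx
  rcases h with h | h
  · exact mem_cycField_of_pow_eq_one hn.pos h
  · have : (-x) ∈ cycField n := mem_cycField_of_pow_eq_one hn.pos (by rw [hn.neg_pow, h, neg_neg])
    simpa using neg_mem this

theorem cycField_two_mul_of_odd {n : ℕ} (hn : Odd n) : cycField (2 * n) = cycField n := by
  refine le_antisymm (cycField_le_iff.2 ?_)
    (cycField_mono (Nat.mul_pos two_pos hn.pos) (dvd_mul_left n 2))
  exact mem_cycField_of_pow_two_mul_eq_one hn
    (zetaRoot_isPrimitiveRoot (Nat.mul_pos two_pos hn.pos)).pow_eq_one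

theorem cycField_isCyclotomicExtension {n : ℕ} (hn : 0 < n) :
    IsCyclotomicExtension {n} ℚ (cycField n) := by
  have : NeZero n := ⟨hn.ne'⟩
  have hz := zetaRoot_isPrimitiveRoot hn
  have hint : IsIntegral ℚ (zetaRoot n) := (hz.isIntegral hn).tower_top
  have h := hz.adjoin_isCyclotomicExtension ℚ
  have e : (cycField n).toSubalgebra = Algebra.adjoin ℚ {zetaRoot n} :=
    adjoin_simple_toSubalgebra_of_isAlgebraic hint.isAlgebraic
  exact IsCyclotomicExtension.equiv {n} ℚ _ (Subalgebra.equivOfEq _ _ e.symm)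

/-- For `t` coprime to `n`, some automorphism of `ℚ_n` raises all `n`-th roots of unity to the
power `t`. -/
theorem exists_algEquiv_pow {n t : ℕ} (hn : 0 < n) (ht : t.Coprime n) :
    ∃ φ : cycField n ≃ₐ[ℚ] cycField n, ∀ x : cycField n, x ^ n = 1 → φ x = x ^ t := by
  have : NeZero n := ⟨hn.ne'⟩
  have := cycField_isCyclotomicExtension hn
  have hz := IsCyclotomicExtension.zeta_spec n ℚ (cycField n)
  refine ⟨IsCyclotomicExtension.fromZetaAut (hz.pow_of_coprime t ht)
    (Polynomial.cyclotomic.irreducible_rat hn), fun x hx ↦ ?_⟩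
  obtain ⟨i, -, rfl⟩ := hz.eq_pow_of_pow_eq_one hx
  rw [map_pow, IsCyclotomicExtension.fromZetaAut_spec, ← pow_mul, ← pow_mul, mul_comm]

/-- The automorphism x ↦ x^t of ℚ_N fixes ℚ_n because t ≡ 1 mod n. The factor z allows for rotated
sums, whose value need not lie in ℚ_n. -/
theorem sum_pow_eq_pow_mul {ι : Type*} [Fintype ι] {n N t : ℕ} (hN : 0 < N) (hn : n ∣ N)
    (ht : t.Coprime N) (htn : t ≡ 1 [MOD n]) {x : ι → ℂ} (hx : ∀ i, x i ^ N = 1) {z α : ℂ}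
    (hz : z ^ N = 1) (hα : α ∈ cycField n) (h : ∑ i, x i = z * α) :
    ∑ i, x i ^ t = z ^ t * α := by
  have hn0 : 0 < n := Nat.pos_of_dvd_of_pos hn hN
  obtain ⟨φ, hφ⟩ := exists_algEquiv_pow hN ht
  have key : ∀ y : cycField N, (y : ℂ) ^ N = 1 → ((φ y : cycField N) : ℂ) = (y : ℂ) ^ t := by
    intro y hy
    rw [hφ y (Subtype.ext (by simpa using hy))]
    simp
  let X : ι → cycField N := fun i ↦ ⟨x i, mem_cycField_of_pow_eq_one hN (hx i)⟩
  let Z : cycField N := ⟨z, mem_cycField_of_pow_eq_one hN hz⟩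
  have hle := cycField_mono hN hn
  let A : cycField N := ⟨α, hle hα⟩
  have hA : φ A = A := by
    let W : cycField N := ⟨zetaRoot n, hle (mem_adjoin_simple_self ℚ _)⟩
    have hW : W ^ n = 1 := Subtype.ext (by
      simpa [W] using (zetaRoot_isPrimitiveRoot hn0).pow_eq_one)
    have hWN : W ^ N = 1 := by
      obtain ⟨k, rfl⟩ := hn
      rw [pow_mul, hW, one_pow]
    have hφW : φ W = W := by
      rw [hφ W hWN]
      conv_rhs => rw [← pow_one W]
      exact pow_eq_pow_of_modEq htn hW
    have hext : ((cycField N).val.comp φ.toAlgHom).comp (inclusion hle) = (cycField n).val := by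
      refine adjoin_algHom_ext ℚ fun y hy ↦ ?_
      obtain rfl : y = zetaRoot n := hy
      exact congrArg Subtype.val hφW
    exact Subtype.ext (DFunLike.congr_fun hext (⟨α, hα⟩ : cycField n))
  have h' : ∑ i, X i = Z * A := Subtype.ext (by simpa [X, Z, A] using h)
  have h2 := congrArg (fun y ↦ ((φ y : cycField N) : ℂ)) h'
  simp only [map_sum, map_mul, hA] at h2
  have e : ∀ i, ((φ (X i) : cycField N) : ℂ) = x i ^ t := fun i ↦ key (X i) (hx i)
  have e2 : ((φ Z : cycField N) : ℂ) = z ^ t := key Z hz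
  push_cast at h2
  simpa [e, e2, A] using h2

/-! ### Averaging over the exponents 1 + jM -/

theorem sum_range_pow_one_add_mul {p M : ℕ} (hp : p.Prime) {y : ℂ} (hy : y ^ (p * M) = 1) :
    ∑ j ∈ Finset.range p, y ^ (1 + j * M) = if y ^ M = 1 then p * y else 0 := by
  have e : ∀ j ∈ Finset.range p, y ^ (1 + j * M) = y * (y ^ M) ^ j := by
    intro j _
    rw [pow_add, pow_one, mul_comm j M, pow_mul]
  rw [Finset.sum_congr rfl e, ← Finset.mul_sum]
  split_ifs with h
  · simp [h, mul_comm]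
  · have hprim : IsPrimitiveRoot (y ^ M) p := by
      rw [IsPrimitiveRoot.iff_orderOf]
      exact orderOf_eq_prime (hp := ⟨hp⟩) (by rw [← pow_mul, mul_comm, hy]) h
    rw [hprim.geom_sum_eq_zero hp.one_lt, mul_zero]

theorem coprime_one_add_mul {p M j : ℕ} (hp : p.Prime) (h : ¬ p ∣ 1 + j * M) :
    (1 + j * M).Coprime (p * M) :=
  Nat.Coprime.mul_right ((hp.coprime_iff_not_dvd.2 h).symm) (by simp)

theorem one_add_mul_modEq_one {n M : ℕ} (h : n ∣ M) (j : ℕ) : 1 + j * M ≡ 1 [MOD n] := by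
  have : j * M ≡ 0 [MOD n] := (Nat.modEq_zero_iff_dvd.2 (h.mul_left j))
  simpa using this.add_left 1

/-- When p ∣ M, every 1 + jM is prime to pM, so the average over j fixes α and kills the terms that
are not M-th roots of unity. -/
theorem sum_filter_eq_of_dvd {ι : Type*} [Fintype ι] {n M p : ℕ} (hp : p.Prime) (hM : 0 < M)
    (hn : n ∣ M) (hpM : p ∣ M) {x : ι → ℂ} (hx : ∀ i, x i ^ (p * M) = 1) {α : ℂ}
    (hα : α ∈ cycField n) (h : ∑ i, x i = α) :
    ∑ i with x i ^ M = 1, x i = α := by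
  have hp0 : (p : ℂ) ≠ 0 := Nat.cast_ne_zero.2 hp.ne_zero
  have h1 : ∀ j ∈ Finset.range p, ∑ i, x i ^ (1 + j * M) = α := by
    intro j _
    have hd : ¬ p ∣ 1 + j * M := fun hd ↦
      hp.one_lt.ne' (Nat.dvd_one.1 ((Nat.dvd_add_left (hpM.mul_left j)).1 hd))
    simpa using sum_pow_eq_pow_mul (Nat.mul_pos hp.pos hM) (hn.mul_left p)
      (coprime_one_add_mul hp hd) (one_add_mul_modEq_one hn j) hx (one_pow _) hα
      (by rw [h, one_mul])
  have h2 := Finset.sum_congr rfl h1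
  rw [Finset.sum_comm] at h2
  simp only [sum_range_pow_one_add_mul hp (hx _), Finset.sum_const, Finset.card_range,
    nsmul_eq_mul] at h2
  rw [← Finset.sum_filter, ← Finset.mul_sum] at h2
  exact mul_left_cancel₀ hp0 h2

/-- When p ∤ M, one of the exponents 1 + jM is divisible by p and gives no automorphism. Subtracting
the family rotated by ζ removes it, since ζ^(1 + jM) = 1 for that j. On the right the ζ^(1 + jM) sum
to zero, so α survives with factor p. -/
theorem sum_filter_sub_sum_filter_eq {ι : Type*} [Fintype ι] {n M p : ℕ} (hp : p.Prime)
    (hM : 0 < M) (hn : n ∣ M) (hpM : ¬ p ∣ M) {x : ι → ℂ} (hx : ∀ i, x i ^ (p * M) = 1) {α : ℂ}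
    (hα : α ∈ cycField n) (h : ∑ i, x i = α) {ζ : ℂ} (hζ : ζ ^ p = 1) (hζ1 : ζ ≠ 1) :
    ∑ i with x i ^ M = 1, x i - ∑ i with (ζ * x i) ^ M = 1, ζ * x i = α := by
  have hp0 : (p : ℂ) ≠ 0 := Nat.cast_ne_zero.2 hp.ne_zero
  have hζN : ζ ^ (p * M) = 1 := by rw [pow_mul, hζ, one_pow]
  have hζx : ∀ i, (ζ * x i) ^ (p * M) = 1 := fun i ↦ by rw [mul_pow, hζN, hx, one_mul]
  have hζM : ζ ^ M ≠ 1 := fun hM1 ↦ hζ1 (by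
    have := (pow_gcd_eq_one (m := p) (n := M) (a := ζ)).2 ⟨hζ, hM1⟩
    rwa [(hp.coprime_iff_not_dvd.2 hpM).gcd_eq_one, pow_one] at this)
  have h1 : ∀ j ∈ Finset.range p, ∑ i, x i ^ (1 + j * M) - ∑ i, (ζ * x i) ^ (1 + j * M) =
      α - ζ ^ (1 + j * M) * α := by
    intro j _
    by_cases hd : p ∣ 1 + j * M
    · have : ζ ^ (1 + j * M) = 1 := by
        obtain ⟨k, hk⟩ := hd
        rw [hk, pow_mul, hζ, one_pow]
      simp [mul_pow, this]
    · have hc := coprime_one_add_mul hp hd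
      have hm := one_add_mul_modEq_one hn j
      have hN := Nat.mul_pos hp.pos hM
      rw [sum_pow_eq_pow_mul hN (hn.mul_left p) hc hm hζx hζN hα (by rw [← Finset.mul_sum, h]),
        sum_pow_eq_pow_mul hN (hn.mul_left p) hc hm hx (one_pow _) hα (by rw [h, one_mul]),
        one_pow, one_mul]
  have h2 := Finset.sum_congr rfl h1
  rw [Finset.sum_sub_distrib, Finset.sum_sub_distrib, Finset.sum_comm,
    Finset.sum_comm (f := fun j i ↦ (ζ * x i) ^ (1 + j * M)), ← Finset.sum_mul,
    sum_range_pow_one_add_mul hp hζN, if_neg hζM] at h2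
  simp only [sum_range_pow_one_add_mul hp (hx _), sum_range_pow_one_add_mul hp (hζx _),
    Finset.sum_const, Finset.card_range, nsmul_eq_mul] at h2
  rw [← Finset.sum_filter, ← Finset.mul_sum, ← Finset.sum_filter, ← Finset.mul_sum, zero_mul,
    sub_zero, ← mul_sub] at h2
  exact mul_left_cancel₀ hp0 h2

/-! ### Shortest representations and the conductor -/

theorem isSumOfRootsOfUnity_finset_sum {ι : Type*} (s : Finset ι) {f : ι → ℂ}
    (hf : ∀ i ∈ s, IsOfFinOrder (f i)) : IsSumOfRootsOfUnity s.card (∑ i ∈ s, f i) := by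
  refine ⟨fun k ↦ f (s.equivFin.symm k), fun k ↦ hf _ (s.equivFin.symm k).2, ?_⟩
  rw [← Finset.sum_coe_sort s f]
  exact Equiv.sum_comp s.equivFin.symm (fun i : s ↦ f i)

theorem isOfFinOrder_neg_one : IsOfFinOrder (-1 : ℂ) :=
  isOfFinOrder_iff_pow_eq_one.2 ⟨2, two_pos, by norm_num⟩

theorem IsOfFinOrder.neg_complex {x : ℂ} (hx : IsOfFinOrder x) : IsOfFinOrder (-x) := by
  rw [← neg_one_mul]
  exact isOfFinOrder_neg_one.mul hx

theorem exists_prime_pow_ne_one {p : ℕ} (hp : p.Prime) (hp2 : p ≠ 2) :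
    ∃ ζ ξ : ℂ, ζ ^ p = 1 ∧ ζ ≠ 1 ∧ ξ ^ p = 1 ∧ ξ ≠ 1 ∧ ζ ≠ ξ := by
  have hz := zetaRoot_isPrimitiveRoot hp.pos
  have h2 : 2 < p := lt_of_le_of_ne hp.two_le hp2.symm
  refine ⟨zetaRoot p, zetaRoot p ^ 2, hz.pow_eq_one, hz.ne_one hp.one_lt, ?_, ?_, ?_⟩
  · rw [← pow_mul, mul_comm, pow_mul, hz.pow_eq_one, one_pow]
  · exact hz.pow_ne_one_of_pos_of_lt two_ne_zero h2
  · intro h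
    have := hz.pow_inj (i := 1) (j := 2) hp.one_lt h2 (by simpa using h)
    omega

/-- If a representation of `α ∈ ℚ_n` as a sum of `pM`-th roots of unity, `n ∣ M`, has as few terms
as possible, then it consists of `M`-th roots of unity. -/
theorem pow_eq_one_of_minimal_sum {ι : Type*} [Fintype ι] {n M p : ℕ} (hp : p.Prime)
    (hM : 0 < M) (hn : n ∣ M) (hpM : p ≠ 2 ∨ p ∣ M) {x : ι → ℂ} (hx : ∀ i, x i ^ (p * M) = 1)
    {α : ℂ} (hα : α ∈ cycField n) (h : ∑ i, x i = α)
    (hmin : ∀ k, IsSumOfRootsOfUnity k α → Fintype.card ι ≤ k) (i : ι) : x i ^ M = 1 := by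
  classical
  have hfin : ∀ i, IsOfFinOrder (x i) := fun i ↦
    isOfFinOrder_iff_pow_eq_one.2 ⟨_, Nat.mul_pos hp.pos hM, hx i⟩
  by_cases hd : p ∣ M
  · have h1 := sum_filter_eq_of_dvd hp hM hn hd hx hα h
    have h2 := hmin _ (h1 ▸ isSumOfRootsOfUnity_finset_sum _ fun i _ ↦ hfin i)
    have h3 := Finset.eq_univ_of_card _ (le_antisymm (Finset.card_le_univ _) h2)
    simpa using (h3 ▸ Finset.mem_univ i :)
  -- An odd p has two distinct nontrivial p-th roots of unity. For each of them minimality leaves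
  -- only two classes for a term, and a term outside the M-th roots of unity would make ζ / ξ an
  -- M-th root of unity.
  · obtain ⟨ζ, ξ, hζ, hζ1, hξ, hξ1, hne⟩ :=
      exists_prime_pow_ne_one hp (hpM.resolve_right hd)
    have hcop : ∀ z : ℂ, z ^ p = 1 → z ^ M = 1 → z = 1 := fun z h1 h2 ↦ by
      have := (pow_gcd_eq_one (m := p) (n := M) (a := z)).2 ⟨h1, h2⟩
      rwa [(hp.coprime_iff_not_dvd.2 hd).gcd_eq_one, pow_one] at this
    have key : ∀ z : ℂ, z ^ p = 1 → z ≠ 1 → ∀ i, x i ^ M = 1 ∨ (z * x i) ^ M = 1 := by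
      intro z hz hz1 i
      have h1 := sum_filter_sub_sum_filter_eq hp hM hn hd hx hα h hz hz1
      have hdisj : Disjoint (Finset.univ.filter fun i ↦ x i ^ M = 1)
          (Finset.univ.filter fun i ↦ (z * x i) ^ M = 1) := by
        rw [Finset.disjoint_filter]
        intro i _ hi hi'
        rw [mul_pow, hi, mul_one] at hi'
        exact hz1 (hcop z hz hi')
      have h2 : ∑ i ∈ (Finset.univ.filter fun i ↦ x i ^ M = 1) ∪
          (Finset.univ.filter fun i ↦ (z * x i) ^ M = 1),
          (if x i ^ M = 1 then x i else -(z * x i)) = α := by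
        rw [Finset.sum_union hdisj, ← h1, sub_eq_add_neg, ← Finset.sum_neg_distrib]
        congr 1
        · exact Finset.sum_congr rfl fun i hi ↦ if_pos (Finset.mem_filter.1 hi).2
        · exact Finset.sum_congr rfl fun i hi ↦
            if_neg fun hi' ↦ Finset.disjoint_left.1 hdisj
              (Finset.mem_filter.2 ⟨Finset.mem_univ _, hi'⟩) hi
      have hzfin : IsOfFinOrder z := isOfFinOrder_iff_pow_eq_one.2 ⟨p, hp.pos, hz⟩
      have h3 := hmin _ (h2 ▸ isSumOfRootsOfUnity_finset_sum _ fun i _ ↦ by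
        split_ifs
        · exact hfin i
        · exact (hzfin.mul (hfin i)).neg_complex)
      have h4 := Finset.eq_univ_of_card _ (le_antisymm (Finset.card_le_univ _) h3)
      simpa using (h4 ▸ Finset.mem_univ i :)
    rcases key ζ hζ hζ1 i with h1 | h1
    · exact h1
    rcases key ξ hξ hξ1 i with h2 | h2
    · exact h2
    exfalso
    have hx0 : x i ≠ 0 := fun h0 ↦ by
      have := hx i
      rw [h0, zero_pow (Nat.mul_pos hp.pos hM).ne'] at this
      exact zero_ne_one this
    have hξ0 : ξ ≠ 0 := fun h0 ↦ by
      rw [h0, zero_pow hp.ne_zero] at hξ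
      exact zero_ne_one hξ
    have h5 : (ζ / ξ) = 1 := by
      refine hcop _ (by rw [div_pow, hζ, hξ, div_one]) ?_
      rw [← mul_div_mul_right ζ ξ hx0, div_pow, h1, h2, div_one]
    exact hne ((div_eq_one_iff_eq hξ0).1 h5)

/-- The primes of k are stripped one at a time. The factor 2 in 2n makes p = 2 divide the remaining
modulus, the only case in which p = 2 is allowed. -/
theorem pow_two_mul_eq_one_of_minimal_sum {ι : Type*} [Fintype ι] {n : ℕ} (hn : 0 < n)
    {x : ι → ℂ} {α : ℂ} (hα : α ∈ cycField n) (h : ∑ i, x i = α)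
    (hmin : ∀ k, IsSumOfRootsOfUnity k α → Fintype.card ι ≤ k) (k : ℕ) (hk : 0 < k)
    (hx : ∀ i, x i ^ (k * (2 * n)) = 1) (i : ι) : x i ^ (2 * n) = 1 := by
  induction k using Nat.strong_induction_on generalizing i with
  | _ k ih =>
    by_cases hk1 : k = 1
    · simpa [hk1] using hx i
    obtain ⟨p, hp, k', rfl⟩ := Nat.exists_prime_and_dvd hk1
    have hk' : 0 < k' := Nat.pos_of_mul_pos_left hk
    refine ih k' (lt_mul_of_one_lt_left hk' hp.one_lt) hk' (fun i ↦ ?_) i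
    refine pow_eq_one_of_minimal_sum hp (M := k' * (2 * n)) (by positivity)
      (dvd_mul_of_dvd_right (dvd_mul_left n 2) _) ?_ (fun i ↦ by rw [← mul_assoc, hx]) hα h hmin i
    by_cases h2 : p = 2
    · right
      rw [h2]
      exact dvd_mul_of_dvd_right (dvd_mul_right 2 n) _
    · exact Or.inl h2

theorem pow_prod_orderOf_mul_eq_one {ι : Type*} [Fintype ι] (x : ι → ℂ) (n : ℕ) (i : ι) :
    x i ^ ((∏ j, orderOf (x j)) * n) = 1 := by
  obtain ⟨c, hc⟩ := Finset.dvd_prod_of_mem (fun j ↦ orderOf (x j)) (Finset.mem_univ i)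
  rw [hc, mul_assoc, pow_mul, pow_orderOf_eq_one, one_pow]

/-- A shortest representation of `α ∈ ℚ_n` as a sum of roots of unity has its terms in `ℚ_n`. -/
theorem pow_eq_one_or_odd_of_minimal_sum {ι : Type*} [Fintype ι] {n : ℕ} (hn : 0 < n)
    {x : ι → ℂ} (hfin : ∀ i, IsOfFinOrder (x i)) {α : ℂ} (hα : α ∈ cycField n)
    (h : ∑ i, x i = α) (hmin : ∀ k, IsSumOfRootsOfUnity k α → Fintype.card ι ≤ k) :
    (∀ i, x i ^ (2 * n) = 1) ∧ (Odd n ∨ ∀ i, x i ^ n = 1) := by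
  have h1 := pow_two_mul_eq_one_of_minimal_sum hn hα h hmin (∏ j, orderOf (x j))
    (Finset.prod_pos fun j _ ↦ (hfin j).orderOf_pos) (pow_prod_orderOf_mul_eq_one x _)
  refine ⟨h1, ?_⟩
  rcases Nat.even_or_odd n with he | ho
  · exact Or.inr fun i ↦ pow_eq_one_of_minimal_sum Nat.prime_two hn dvd_rfl
      (Or.inr he.two_dvd) h1 hα h hmin i
  · exact Or.inl ho

/-- The conductor of `α` and the least common multiple of the orders of the terms of a shortest
representation of `α` give the same cyclotomic field. -/
theorem cycField_cycConductor_eq {ι : Type*} [Fintype ι] {x : ι → ℂ}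
    (hfin : ∀ i, IsOfFinOrder (x i)) {α : ℂ} (h : ∑ i, x i = α)
    (hmin : ∀ k, IsSumOfRootsOfUnity k α → Fintype.card ι ≤ k) {m : ℕ} (hm : 0 < m)
    (hxm : ∀ k, (∀ i, x i ^ k = 1) ↔ m ∣ k) :
    cycField (cycConductor α) = cycField m := by
  have hmem : α ∈ cycField m := h ▸ sum_mem fun i _ ↦
    mem_cycField_of_pow_eq_one hm ((hxm m).2 dvd_rfl i)
  have hle : ∀ n, 0 < n → α ∈ cycField n → cycConductor α ≤ n := fun n hn hα ↦
    Nat.sInf_le (show _ ∧ _ from ⟨hn, adjoin_simple_le_iff.2 hα⟩)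
  obtain ⟨hn, hα⟩ : 0 < cycConductor α ∧ adjoin ℚ {α} ≤ cycField (cycConductor α) :=
    Nat.sInf_mem (s := {n : ℕ | 0 < n ∧ adjoin ℚ {α} ≤ cycField n})
      ⟨m, hm, adjoin_simple_le_iff.2 hmem⟩
  have hα' := adjoin_simple_le_iff.1 hα
  have hlem := hle m hm hmem
  obtain ⟨h2, h1⟩ := pow_eq_one_or_odd_of_minimal_sum hn hfin hα' h hmin
  generalize cycConductor α = n at *
  have heq : m ∣ n → cycField n = cycField m := fun hd ↦ by
    rw [le_antisymm hlem (Nat.le_of_dvd hn hd)]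
  rcases h1 with ho | h1
  -- For odd n the lcm m may be 2n, as -1 is rational. This is why the fields, and not the numbers,
  -- are compared.
  · rcases Nat.even_or_odd m with he | hmo
    · obtain ⟨m', rfl⟩ := he.two_dvd
      have hd : m' ∣ n := Nat.dvd_of_mul_dvd_mul_left two_pos ((hxm _).1 h2)
      have ho' : Odd m' := ho.of_dvd_nat hd
      rw [cycField_two_mul_of_odd ho'] at hmem ⊢
      rw [le_antisymm (hle m' ho'.pos hmem) (Nat.le_of_dvd hn hd)]
    · exact heq ((Nat.coprime_two_right.2 hmo).dvd_of_dvd_mul_left ((hxm _).1 h2))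
  · exact heq ((hxm n).1 h1)

/-- Suitable powers of two roots of unity multiply to a root whose order is the lcm of theirs, so
the terms generate a primitive m-th root of unity. -/
theorem exists_lcm_orders {ι : Type*} [Fintype ι] {x : ι → ℂ} (hfin : ∀ i, IsOfFinOrder (x i)) :
    ∃ m, 0 < m ∧ (∀ k, (∀ i, x i ^ k = 1) ↔ m ∣ k) ∧ cycField m ≤ adjoin ℚ (Set.range x) := by
  classical
  suffices H : ∀ s : Finset ι, ∃ m, 0 < m ∧ (∀ k, (∀ i ∈ s, x i ^ k = 1) ↔ m ∣ k) ∧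
      ∃ η ∈ adjoin ℚ (Set.range x), IsPrimitiveRoot η m by
    obtain ⟨m, hm, hk, η, hη, hp⟩ := H Finset.univ
    refine ⟨m, hm, by simpa using hk, cycField_le_iff.2 ?_⟩
    have : NeZero m := ⟨hm.ne'⟩
    obtain ⟨i, -, hi⟩ := hp.eq_pow_of_pow_eq_one (zetaRoot_isPrimitiveRoot hm).pow_eq_one
    exact hi ▸ pow_mem hη i
  intro s
  induction s using Finset.induction_on with
  | empty => exact ⟨1, one_pos, by simp, 1, one_mem _, IsPrimitiveRoot.one⟩
  | insert a s ha ih =>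
    obtain ⟨m, hm, hk, η, hη, hp⟩ := ih
    refine ⟨Nat.lcm (orderOf (x a)) m, Nat.lcm_pos (hfin a).orderOf_pos hm, fun k ↦ ?_, _, ?_,
      (IsPrimitiveRoot.orderOf (x a)).pow_mul_pow_lcm hp (hfin a).orderOf_pos.ne' hm.ne'⟩
    · rw [Finset.forall_mem_insert, hk, ← orderOf_dvd_iff_pow_eq_one, Nat.lcm_dvd_iff]
    · exact mul_mem (pow_mem (subset_adjoin ℚ _ (Set.mem_range_self a)) _) (pow_mem hη _)

/-! ### Sums of two numbers of modulus one -/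

theorem mul_eq_one_of_add_eq_one {v v' : ℂ} (hv : ‖v‖ = 1) (hv' : ‖v'‖ = 1) (h : v + v' = 1) :
    v * v' = 1 := by
  have h1 : v * (starRingEnd ℂ) v = 1 := by rw [Complex.mul_conj']; simp [hv]
  have h2 : v' * (starRingEnd ℂ) v' = 1 := by rw [Complex.mul_conj']; simp [hv']
  have h3 : (starRingEnd ℂ) v + (starRingEnd ℂ) v' = 1 := by rw [← map_add, h, map_one]
  linear_combination -(v * v') * h3 + v' * h1 + v * h2 + h

/-- On the unit circle conjugation is inversion, so a nonzero sum s = a + b determines ab = s / s̄,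
and with it the quadratic whose roots are a and b. -/
theorem eq_or_eq_of_add_eq_add {a b c d : ℂ} (ha : ‖a‖ = 1) (hb : ‖b‖ = 1) (hc : ‖c‖ = 1)
    (hd : ‖d‖ = 1) (h : a + b = c + d) (h0 : a + b ≠ 0) : c = a ∨ c = b := by
  have h1 : a * (starRingEnd ℂ) a = 1 := by rw [Complex.mul_conj']; simp [ha]
  have h2 : b * (starRingEnd ℂ) b = 1 := by rw [Complex.mul_conj']; simp [hb]
  have h3 : c * (starRingEnd ℂ) c = 1 := by rw [Complex.mul_conj']; simp [hc]
  have h4 : d * (starRingEnd ℂ) d = 1 := by rw [Complex.mul_conj']; simp [hd]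
  have h5 := congrArg (starRingEnd ℂ) h
  rw [map_add, map_add] at h5
  have h6 : (starRingEnd ℂ) (a + b) ≠ 0 := (map_ne_zero _).2 h0
  rw [map_add] at h6
  have h7 : a * b = c * d := by
    apply mul_right_cancel₀ h6
    have e1 : a * b * ((starRingEnd ℂ) a + (starRingEnd ℂ) b) = a + b := by
      linear_combination b * h1 + a * h2
    have e2 : c * d * ((starRingEnd ℂ) c + (starRingEnd ℂ) d) = c + d := by
      linear_combination d * h3 + c * h4
    rw [e1, h5, e2, h]
  have h8 : (c - a) * (c - b) = 0 := by linear_combination h7 - c * h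
  rcases mul_eq_zero.1 h8 with h | h
  · exact Or.inl (sub_eq_zero.1 h)
  · exact Or.inr (sub_eq_zero.1 h)

theorem IsOfFinOrder.inv_complex {x : ℂ} (hx : IsOfFinOrder x) : IsOfFinOrder x⁻¹ := by
  obtain ⟨n, hn, h⟩ := isOfFinOrder_iff_pow_eq_one.1 hx
  exact isOfFinOrder_iff_pow_eq_one.2 ⟨n, hn, by rw [inv_pow, h, inv_one]⟩

theorem zero_mem_cycField (n : ℕ) : (0 : ℂ) ∈ cycField n := zero_mem _

/-! ### Minimal vanishing sums of six roots of unity -/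

section Minimal

variable {ι : Type*} [Fintype ι] {x : ι → ℂ}

/-- If no proper subsum of a vanishing sum of `pM`-th roots of unity vanishes, one of the terms is
`1` and not all of them are `M`-th roots of unity, then `p ∤ M` and each class modulo the `M`-th
roots of unity is represented. -/
theorem exists_pow_eq_one_of_minimal_vanishing (h0 : ∑ i, x i = 0)
    (hmin : ∀ s : Finset ι, ∑ i ∈ s, x i = 0 → s = ∅ ∨ s = Finset.univ) {i₀ : ι}
    (hi₀ : x i₀ = 1) {p M : ℕ} (hp : p.Prime) (hM : 0 < M) (hx : ∀ i, x i ^ (p * M) = 1)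
    (hne : ¬ ∀ i, x i ^ M = 1) :
    ¬ p ∣ M ∧ ∀ ζ : ℂ, ζ ^ p = 1 → ∃ i, (ζ * x i) ^ M = 1 := by
  have huniv : ∑ i with x i ^ M = 1, x i ≠ 0 := by
    intro h
    rcases hmin _ h with h | h
    · have : i₀ ∈ Finset.univ.filter fun i ↦ x i ^ M = 1 := by simp [hi₀]
      rw [h] at this
      simp at this
    · refine hne fun i ↦ ?_
      simpa using (h ▸ Finset.mem_univ i :)
  have hd : ¬ p ∣ M := fun hd ↦
    huniv (sum_filter_eq_of_dvd hp hM (one_dvd M) hd hx (zero_mem_cycField 1) h0)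
  refine ⟨hd, fun ζ hζ ↦ ?_⟩
  by_cases hζ1 : ζ = 1
  · exact ⟨i₀, by simp [hζ1, hi₀]⟩
  by_contra hcon
  push Not at hcon
  have h1 := sum_filter_sub_sum_filter_eq hp hM (one_dvd M) hd hx (zero_mem_cycField 1) h0 hζ hζ1
  rw [Finset.filter_false_of_mem (p := fun i ↦ (ζ * x i) ^ M = 1) fun i _ ↦ hcon i,
    Finset.sum_empty, sub_zero] at h1
  exact huniv h1

/-- No term is -1, since it would cancel the term 1. If no term were ζ⁻¹ for some cube root ζ ≠ 1, a
positive count would equal minus a count. So 1, ω and ω² all occur, and they form a proper vanishing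
subsum. -/
theorem not_forall_pow_six_eq_one [DecidableEq ι] (hcard : Fintype.card ι = 6)
    (h0 : ∑ i, x i = 0)
    (hmin : ∀ s : Finset ι, ∑ i ∈ s, x i = 0 → s = ∅ ∨ s = Finset.univ) {i₀ : ι}
    (hi₀ : x i₀ = 1) : ¬ ∀ i, x i ^ 6 = 1 := by
  intro hx
  have hsmall : ∀ s : Finset ι, s.Nonempty → s.card < 6 → ∑ i ∈ s, x i ≠ 0 := by
    intro s hs hc h
    rcases hmin s h with rfl | rfl
    · exact Finset.not_nonempty_empty hs
    · rw [Finset.card_univ, hcard] at hc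
      exact lt_irrefl _ hc
  have hneg : ∀ i, x i ≠ -1 := by
    intro i hi
    have hne : i₀ ≠ i := by
      rintro rfl
      rw [hi₀] at hi
      norm_num at hi
    refine hsmall {i₀, i} (by simp) (lt_of_le_of_lt (Finset.card_le_two) (by norm_num)) ?_
    rw [Finset.sum_pair hne, hi₀, hi]
    ring
  have hclass : ∀ i, x i ^ 2 = 1 → x i = 1 := fun i hi ↦
    (_root_.sq_eq_one_iff.1 hi).resolve_right (hneg i)
  have key : ∀ ζ : ℂ, ζ ^ 3 = 1 → ζ ≠ 1 → ∃ i, ζ * x i = 1 := by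
    intro ζ hζ hζ1
    by_contra hcon
    push Not at hcon
    have h1 := sum_filter_sub_sum_filter_eq (M := 2) Nat.prime_three two_pos (one_dvd 2)
      (by norm_num) hx (zero_mem_cycField 1) h0 hζ hζ1
    have e1 : ∑ i with x i ^ 2 = 1, x i = ((Finset.univ.filter fun i ↦ x i ^ 2 = 1).card : ℂ) := by
      rw [Finset.sum_congr rfl fun i hi ↦ hclass i (Finset.mem_filter.1 hi).2]
      simp
    have e2 : ∑ i with (ζ * x i) ^ 2 = 1, ζ * x i =
        -((Finset.univ.filter fun i ↦ (ζ * x i) ^ 2 = 1).card : ℂ) := by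
      rw [Finset.sum_congr rfl fun i hi ↦
        ((_root_.sq_eq_one_iff.1 (Finset.mem_filter.1 hi).2).resolve_left (hcon i))]
      simp
    rw [e1, e2, sub_neg_eq_add] at h1
    norm_cast at h1
    have h2 : (Finset.univ.filter fun i ↦ x i ^ 2 = 1).card = 0 := by omega
    have h3 : i₀ ∈ Finset.univ.filter fun i ↦ x i ^ 2 = 1 := by simp [hi₀]
    rw [Finset.card_eq_zero.1 h2] at h3
    simp at h3
  have hz := zetaRoot_isPrimitiveRoot (n := 3) (by norm_num)
  set w := zetaRoot 3 with hw
  have hw3 : w ^ 3 = 1 := hz.pow_eq_one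
  have hw1 : w ≠ 1 := hz.ne_one (by norm_num)
  have hw2 : w ^ 2 ≠ 1 := hz.pow_ne_one_of_pos_of_lt two_ne_zero (by norm_num)
  have hsum : 1 + w + w ^ 2 = 0 := by
    have := hz.geom_sum_eq_zero (by norm_num)
    simpa [Finset.sum_range_succ] using this
  obtain ⟨i, hi⟩ := key w hw3 hw1
  obtain ⟨j, hj⟩ := key (w ^ 2) (by rw [← pow_mul, mul_comm, pow_mul, hw3, one_pow]) hw2
  have hi' : x i = w ^ 2 := by linear_combination w ^ 2 * hi - x i * hw3
  have hj' : x j = w := by linear_combination w * hj - x j * hw3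
  have h0i : i₀ ≠ i := by
    rintro rfl
    exact hw2 (hi'.symm.trans hi₀)
  have h0j : i₀ ≠ j := by
    rintro rfl
    exact hw1 (hj'.symm.trans hi₀)
  have hij : i ≠ j := by
    rintro rfl
    apply hw1
    have h := hi'.symm.trans hj'
    linear_combination hw3 - w * h - h
  refine hsmall {i₀, i, j} (by simp) (lt_of_le_of_lt Finset.card_le_three (by norm_num)) ?_
  rw [Finset.sum_insert (by simp [h0i, h0j]), Finset.sum_pair hij, hi₀, hi', hj', ← hsum]
  ring

/-- The classes modulo `M` of the terms of a minimal vanishing sum of `pM`-th roots of unity. -/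
theorem exists_injective_of_minimal_vanishing (h0 : ∑ i, x i = 0)
    (hmin : ∀ s : Finset ι, ∑ i ∈ s, x i = 0 → s = ∅ ∨ s = Finset.univ) {i₀ : ι}
    (hi₀ : x i₀ = 1) {p M : ℕ} (hp : p.Prime) (hM : 0 < M) (hx : ∀ i, x i ^ (p * M) = 1)
    (hne : ¬ ∀ i, x i ^ M = 1) :
    ¬ p ∣ M ∧ (∀ i (a b : Fin p), (zetaRoot p ^ (a : ℕ) * x i) ^ M = 1 →
        (zetaRoot p ^ (b : ℕ) * x i) ^ M = 1 → a = b) ∧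
      ∃ c : Fin p → ι, Function.Injective c ∧
        ∀ a : Fin p, (zetaRoot p ^ (a : ℕ) * x (c a)) ^ M = 1 := by
  obtain ⟨hd, h⟩ := exists_pow_eq_one_of_minimal_vanishing h0 hmin hi₀ hp hM hx hne
  have hz := zetaRoot_isPrimitiveRoot hp.pos
  have hzM : IsPrimitiveRoot (zetaRoot p ^ M) p :=
    hz.pow_of_coprime M ((hp.coprime_iff_not_dvd.2 hd).symm)
  have huniq : ∀ i (a b : Fin p), (zetaRoot p ^ (a : ℕ) * x i) ^ M = 1 →
      (zetaRoot p ^ (b : ℕ) * x i) ^ M = 1 → a = b := by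
    intro i a b ha hb
    have hx0 : x i ^ M ≠ 0 := fun h0 ↦ by
      have := hx i
      rw [mul_comm, pow_mul, h0, zero_pow hp.ne_zero] at this
      exact zero_ne_one this
    rw [mul_pow] at ha hb
    have hab := mul_right_cancel₀ hx0 (ha.trans hb.symm)
    rw [← pow_mul, ← pow_mul, mul_comm, mul_comm (b : ℕ), pow_mul, pow_mul] at hab
    exact Fin.ext (hzM.pow_inj a.2 b.2 hab)
  refine ⟨hd, huniq, ?_⟩
  choose c hc using fun a : Fin p ↦ h (zetaRoot p ^ (a : ℕ))
    (by rw [← pow_mul, mul_comm, pow_mul, hz.pow_eq_one, one_pow])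
  exact ⟨c, fun a b hab ↦ huniq (c a) a b (hc a) (hab ▸ hc b), hc⟩

/-- The six terms fill five classes modulo M-th roots of unity, so one class has two terms and the
others one. The class sums agree up to fifth roots of unity. Hence the sum ε of the double class is
itself a root of unity, and every single term is ε times a nontrivial fifth root of unity. -/
theorem exists_golden_of_pow_five_mul [DecidableEq ι] (hcard : Fintype.card ι = 6)
    (hfin : ∀ i, IsOfFinOrder (x i)) (h0 : ∑ i, x i = 0)
    (hmin : ∀ s : Finset ι, ∑ i ∈ s, x i = 0 → s = ∅ ∨ s = Finset.univ) {i₀ : ι}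
    (hi₀ : x i₀ = 1) {M : ℕ} (hM : 0 < M) (hx : ∀ i, x i ^ (5 * M) = 1)
    (hne : ¬ ∀ i, x i ^ M = 1) :
    ∃ (ε w : ℂ) (k l : ι), IsOfFinOrder ε ∧ w ^ 2 + w + 1 = 0 ∧ k ≠ l ∧ x k = -(ε * w) ∧
      x l = -(ε * w ^ 2) ∧ (∀ i, i ≠ k → i ≠ l → x i ^ 5 = ε ^ 5 ∧ x i ≠ ε) ∧
      ∀ i j, i ≠ k → i ≠ l → j ≠ k → j ≠ l → x i = x j → i = j := by
  have hp := Nat.prime_five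
  obtain ⟨hd, huniq, c, hcinj, hc⟩ :=
    exists_injective_of_minimal_vanishing h0 hmin hi₀ hp hM hx hne
  have hz := zetaRoot_isPrimitiveRoot hp.pos
  have hzM : IsPrimitiveRoot (zetaRoot 5 ^ M) 5 :=
    hz.pow_of_coprime M ((hp.coprime_iff_not_dvd.2 hd).symm)
  set z := zetaRoot 5 with hzdef
  have hcardim : (Finset.univ.image c).card = 5 := by
    rw [Finset.card_image_of_injective _ hcinj]
    simp
  obtain ⟨k, hk⟩ : ∃ k, (Finset.univ.image c)ᶜ = {k} := by
    rw [← Finset.card_eq_one, Finset.card_compl, hcardim, hcard]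
  have hkc : ∀ i, (∃ a, c a = i) ↔ i ≠ k := fun i ↦ by
    have : i ∈ (Finset.univ.image c)ᶜ ↔ i = k := by rw [hk]; simp
    rw [← not_iff_not, not_not, ← this]
    simp
  obtain ⟨a₀, ha₀⟩ : ∃ a : Fin 5, (z ^ (a : ℕ) * x k) ^ M = 1 := by
    have h1 : (x k ^ M)⁻¹ ^ 5 = 1 := by rw [inv_pow, ← pow_mul, mul_comm, hx, inv_one]
    obtain ⟨a, ha, hea⟩ := hzM.eq_pow_of_pow_eq_one h1
    have hxk : x k ^ M ≠ 0 := pow_ne_zero _ (hfin k).isUnit.ne_zero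
    refine ⟨⟨a, ha⟩, ?_⟩
    rw [mul_pow, ← pow_mul, mul_comm a, pow_mul, hea, inv_mul_cancel₀ hxk]
  have hkl : k ≠ c a₀ := ((hkc _).1 ⟨a₀, rfl⟩).symm
  have hclass : ∀ (a : Fin 5) i, (z ^ (a : ℕ) * x i) ^ M = 1 ↔ i = c a ∨ (i = k ∧ a = a₀) := by
    intro a i
    constructor
    · intro h
      by_cases hik : i = k
      · exact Or.inr ⟨hik, huniq k a a₀ (hik ▸ h) ha₀⟩
      · obtain ⟨b, rfl⟩ := (hkc i).2 hik
        exact Or.inl (by rw [huniq _ a b h (hc b)])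
    · rintro (rfl | ⟨rfl, rfl⟩)
      · exact hc a
      · exact ha₀
  have hsums : ∀ a : Fin 5, ∑ i with (z ^ (a : ℕ) * x i) ^ M = 1, z ^ (a : ℕ) * x i =
      ∑ i with x i ^ M = 1, x i := by
    intro a
    by_cases h1 : z ^ (a : ℕ) = 1
    · simp [h1]
    · have := sum_filter_sub_sum_filter_eq hp hM (one_dvd M) hd hx (zero_mem_cycField 1) h0
        (by rw [← pow_mul, mul_comm, pow_mul, hz.pow_eq_one, one_pow]) h1
      exact (sub_eq_zero.1 this).symm
  have hother : ∀ a, a ≠ a₀ → z ^ (a : ℕ) * x (c a) = z ^ (a₀ : ℕ) * (x k + x (c a₀)) := by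
    intro a ha
    have h1 : (Finset.univ.filter fun i ↦ (z ^ (a : ℕ) * x i) ^ M = 1) = {c a} := by
      ext i
      simp [hclass, ha]
    have h2 : (Finset.univ.filter fun i ↦ (z ^ (a₀ : ℕ) * x i) ^ M = 1) = {k, c a₀} := by
      ext i
      simp [hclass, or_comm]
    have h3 := (hsums a).trans (hsums a₀).symm
    rw [h1, h2, Finset.sum_singleton, Finset.sum_pair hkl] at h3
    rw [h3]
    ring
  have hpow5 : ∀ a : ℕ, (z ^ a) ^ 5 = 1 := fun a ↦ by
    rw [← pow_mul, mul_comm, pow_mul, hz.pow_eq_one, one_pow]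
  set ε := x k + x (c a₀) with hε
  have hother5 : ∀ a, a ≠ a₀ → x (c a) ^ 5 = ε ^ 5 := by
    intro a ha
    have := congrArg (· ^ 5) (hother a ha)
    simpa only [mul_pow, hpow5, one_mul] using this
  obtain ⟨a₁, ha₁⟩ : ∃ a₁, a₁ ≠ a₀ := exists_ne a₀
  have hεfin : IsOfFinOrder ε := by
    obtain ⟨n, hn, h⟩ := isOfFinOrder_iff_pow_eq_one.1 (hfin (c a₁))
    refine isOfFinOrder_iff_pow_eq_one.2 ⟨5 * n, by omega, ?_⟩
    rw [pow_mul, ← hother5 a₁ ha₁, ← pow_mul, mul_comm, pow_mul, h, one_pow]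
  have hε0 : ε ≠ 0 := hεfin.isUnit.ne_zero
  -- Two numbers of modulus one with sum 1 have product 1, so they are -ω and -ω².
  have hvv : x k / ε * (x (c a₀) / ε) = 1 := by
    refine mul_eq_one_of_add_eq_one ?_ ?_ (by rw [← add_div, ← hε, div_self hε0])
    · rw [norm_div, (hfin k).norm_eq_one, hεfin.norm_eq_one, div_one]
    · rw [norm_div, (hfin _).norm_eq_one, hεfin.norm_eq_one, div_one]
  have hvv' : x k / ε + x (c a₀) / ε = 1 := by rw [← add_div, ← hε, div_self hε0]
  have hw : (-(x k / ε)) ^ 2 + (-(x k / ε)) + 1 = 0 := by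
    linear_combination (x k / ε) * hvv' - hvv
  have hget : ∀ i, i ≠ k → i ≠ c a₀ → ∃ a, a ≠ a₀ ∧ c a = i := by
    intro i h1 h2
    obtain ⟨a, rfl⟩ := (hkc i).2 h1
    exact ⟨a, fun h ↦ h2 (h ▸ rfl), rfl⟩
  refine ⟨ε, -(x k / ε), k, c a₀, hεfin, hw, hkl, ?_, ?_, fun i h1 h2 ↦ ?_,
    fun i j hi1 hi2 hj1 hj2 hij ↦ ?_⟩
  · field_simp
  · have : x (c a₀) = ε * (x (c a₀) / ε) := by field_simp
    rw [this]
    linear_combination ε * hvv' + ε * hw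
  · obtain ⟨a, ha, rfl⟩ := hget i h1 h2
    refine ⟨hother5 a ha, fun h ↦ ha ?_⟩
    have h3 := hother a ha
    rw [h] at h3
    exact Fin.ext (hz.pow_inj a.2 a₀.2 (mul_right_cancel₀ hε0 h3))
  · obtain ⟨a, ha, rfl⟩ := hget i hi1 hi2
    obtain ⟨b, hb, rfl⟩ := hget j hj1 hj2
    have h3 := (hother a ha).trans (hother b hb).symm
    rw [hij] at h3
    rw [Fin.ext (hz.pow_inj a.2 b.2 (mul_right_cancel₀ (hfin _).isUnit.ne_zero h3))]

/-- A minimal vanishing sum of six roots of unity is, up to a rotation,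
`-ω - ω² + ζ₅ + ζ₅² + ζ₅³ + ζ₅⁴`. -/
theorem exists_golden_of_minimal_vanishing (hcard : Fintype.card ι = 6)
    (hfin : ∀ i, IsOfFinOrder (x i)) (h0 : ∑ i, x i = 0)
    (hmin : ∀ s : Finset ι, ∑ i ∈ s, x i = 0 → s = ∅ ∨ s = Finset.univ) :
    ∃ (ε w : ℂ) (k l : ι), IsOfFinOrder ε ∧ w ^ 2 + w + 1 = 0 ∧ k ≠ l ∧ x k = -(ε * w) ∧
      x l = -(ε * w ^ 2) ∧ (∀ i, i ≠ k → i ≠ l → x i ^ 5 = ε ^ 5 ∧ x i ≠ ε) ∧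
      ∀ i j, i ≠ k → i ≠ l → j ≠ k → j ≠ l → x i = x j → i = j := by
  classical
  obtain ⟨i₀⟩ : Nonempty ι := Fintype.card_pos_iff.1 (by omega)
  wlog hi₀ : x i₀ = 1 generalizing x
  · have hx0 : x i₀ ≠ 0 := (hfin i₀).isUnit.ne_zero
    have hs : ∀ s : Finset ι, ∑ i ∈ s, x i / x i₀ = (∑ i ∈ s, x i) / x i₀ := fun s ↦
      (Finset.sum_div _ _ _).symm
    obtain ⟨ε, w, k, l, hε, hw, hkl, h1, h2, h3, h4⟩ := this (x := fun i ↦ x i / x i₀)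
      (fun i ↦ by
        rw [div_eq_mul_inv]
        exact (hfin i).mul (hfin i₀).inv_complex)
      (by rw [hs, h0, zero_div])
      (fun s h ↦ hmin s (by
        rw [hs, div_eq_zero_iff] at h
        exact h.resolve_right hx0))
      (div_self hx0)
    refine ⟨ε * x i₀, w, k, l, hε.mul (hfin i₀), hw, hkl, ?_, ?_, fun i hik hil ↦ ⟨?_, ?_⟩,
      fun i j hi1 hi2 hj1 hj2 hij ↦ h4 i j hi1 hi2 hj1 hj2 (by rw [hij])⟩
    · rw [div_eq_iff hx0] at h1
      rw [h1]
      ring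
    · rw [div_eq_iff hx0] at h2
      rw [h2]
      ring
    · have := (h3 i hik hil).1
      rw [div_pow, div_eq_iff (pow_ne_zero 5 hx0)] at this
      rw [this, mul_pow]
    · have := (h3 i hik hil).2
      rwa [ne_eq, div_eq_iff hx0] at this
  -- Taking the least common exponent N ensures that N / p is not an exponent, for every prime p
  -- dividing N.
  have hex : ∃ N, 0 < N ∧ ∀ i, x i ^ N = 1 :=
    ⟨_, Nat.mul_pos (Finset.prod_pos fun j _ ↦ (hfin j).orderOf_pos) one_pos,
      pow_prod_orderOf_mul_eq_one x 1⟩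
  obtain ⟨hN, hx⟩ := Nat.find_spec hex
  have hNmin : ∀ M, 0 < M → M < Nat.find hex → ¬ ∀ i, x i ^ M = 1 := fun M hM hlt h ↦
    Nat.find_min hex hlt ⟨hM, h⟩
  generalize Nat.find hex = N at *
  have hfactor : ∀ p M, p.Prime → N = p * M → 0 < M ∧ ¬ ∀ i, x i ^ M = 1 := by
    rintro p M hp rfl
    have hM : 0 < M := Nat.pos_of_mul_pos_left hN
    exact ⟨hM, hNmin M hM (lt_mul_of_one_lt_left hM hp.one_lt)⟩
  by_cases h5 : 5 ∣ N
  · obtain ⟨M, rfl⟩ := h5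
    obtain ⟨hM, hne⟩ := hfactor 5 M Nat.prime_five rfl
    exact exists_golden_of_pow_five_mul hcard hfin h0 hmin hi₀ hM hx hne
  -- N is squarefree, and a prime p dividing N needs p nonempty classes among six terms. Without 5
  -- this leaves N ∣ 6.
  · exfalso
    have hsq : Squarefree N := by
      rw [Nat.squarefree_iff_prime_squarefree]
      rintro p hp ⟨K, rfl⟩
      obtain ⟨hM, hne⟩ := hfactor p (p * K) hp (mul_assoc _ _ _)
      rw [mul_assoc] at hx
      exact (exists_pow_eq_one_of_minimal_vanishing h0 hmin hi₀ hp hM hx hne).1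
        (dvd_mul_right p K)
    have hsub : N.primeFactors ⊆ {2, 3} := by
      intro p hp
      have hpp := Nat.prime_of_mem_primeFactors hp
      obtain ⟨M, rfl⟩ := Nat.dvd_of_mem_primeFactors hp
      obtain ⟨hM, hne⟩ := hfactor p M hpp rfl
      obtain ⟨-, -, c, hc, -⟩ :=
        exists_injective_of_minimal_vanishing h0 hmin hi₀ hpp hM hx hne
      have hle : p ≤ 6 := by simpa [hcard] using Fintype.card_le_of_injective c hc
      have h2 := hpp.two_le
      have hp5 : p ≠ 5 := by
        rintro rfl
        exact h5 (dvd_mul_right 5 M)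
      interval_cases p
      · simp
      · simp
      · exact absurd hpp (by norm_num)
      · exact absurd rfl hp5
      · exact absurd hpp (by norm_num)
    have hdvd : N ∣ 6 := by
      rw [← Nat.prod_primeFactors_of_squarefree hsq]
      exact Finset.prod_dvd_prod_of_subset _ {2, 3} (fun p ↦ p) hsub
    obtain ⟨K, hK⟩ := hdvd
    exact not_forall_pow_six_eq_one hcard h0 hmin hi₀ fun i ↦ by rw [hK, pow_mul, hx, one_pow]

end Minimal

/-! ### Two representations of a sum of length three -/

theorem exists_sum_fin_three_eq (a b : Fin 3) (h : a ≠ b) :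
    ∃ c, a ≠ c ∧ b ≠ c ∧ (∀ i, i = a ∨ i = b ∨ i = c) ∧
      ∀ g : Fin 3 → ℂ, ∑ i, g i = g a + g b + g c := by
  have hc : ∃ c, a ≠ c ∧ b ≠ c ∧ (∀ i, i = a ∨ i = b ∨ i = c) := by
    revert a b
    decide
  obtain ⟨c, h1, h2, h3⟩ := hc
  refine ⟨c, h1, h2, h3, fun g ↦ ?_⟩
  have : (Finset.univ : Finset (Fin 3)) = {a, b, c} := by
    ext i
    simpa using h3 i
  rw [this, Finset.sum_insert (by simp [h, h1]), Finset.sum_pair h2, add_assoc]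

theorem isSumOfRootsOfUnity_two {a b : ℂ} (ha : IsOfFinOrder a) (hb : IsOfFinOrder b) :
    IsSumOfRootsOfUnity 2 (a + b) :=
  ⟨![a, b], by simp [Fin.forall_fin_two, ha, hb], by simp⟩

theorem isSumOfRootsOfUnity_one {a : ℂ} (ha : IsOfFinOrder a) : IsSumOfRootsOfUnity 1 a :=
  ⟨![a], by simp [ha], by simp⟩

section

variable {e f : Fin 3 → ℂ}

theorem add_ne_zero_of_minimal (he : ∀ i, IsOfFinOrder (e i))
    (hmin : ∀ k, IsSumOfRootsOfUnity k (∑ i, e i) → 3 ≤ k) {i j : Fin 3} (hij : i ≠ j) :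
    e i + e j ≠ 0 := by
  intro h
  obtain ⟨k, -, -, -, hk⟩ := exists_sum_fin_three_eq i j hij
  have := hmin 1 (by
    rw [hk, h, zero_add]
    exact isSumOfRootsOfUnity_one (he k))
  omega

theorem range_subset_of_common_term (he : ∀ i, IsOfFinOrder (e i)) (hf : ∀ i, IsOfFinOrder (f i))
    (h : ∑ i, e i = ∑ i, f i) (hmin : ∀ k, IsSumOfRootsOfUnity k (∑ i, e i) → 3 ≤ k)
    {i j : Fin 3} (hij : f j = e i) (k : Fin 3) : ∃ l, f k = e l := by
  by_cases hkj : k = j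
  · exact ⟨i, hkj ▸ hij⟩
  obtain ⟨k', -, -, -, hk'⟩ := exists_sum_fin_three_eq k j hkj
  obtain ⟨l, hl⟩ := exists_ne i
  obtain ⟨l', h1, -, -, hl'⟩ := exists_sum_fin_three_eq l i hl
  have h2 : e l + e l' = f k + f k' := by
    rw [hk' f, hl' e, hij] at h
    linear_combination h
  rcases eq_or_eq_of_add_eq_add (he l).norm_eq_one (he l').norm_eq_one (hf k).norm_eq_one
    (hf k').norm_eq_one h2 (add_ne_zero_of_minimal he hmin h1) with h3 | h3
  · exact ⟨l, h3⟩
  · exact ⟨l', h3⟩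

/-- Exchanging the terms in A for those in B gives a representation with 3 - |A| + |B| terms. -/
theorem card_le_card_of_sum_eq_sum (he : ∀ i, IsOfFinOrder (e i)) (hf : ∀ i, IsOfFinOrder (f i))
    (hmin : ∀ k, IsSumOfRootsOfUnity k (∑ i, e i) → 3 ≤ k) {A B : Finset (Fin 3)}
    (hAB : ∑ i ∈ A, e i = ∑ i ∈ B, f i) : A.card ≤ B.card := by
  have h1 : ∑ i ∈ Aᶜ.disjSum B, Sum.elim e f i = ∑ i, e i := by
    rw [Finset.sum_disjSum, ← Finset.sum_compl_add_sum A]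
    simp [hAB]
  have h2 := hmin _ (h1 ▸ isSumOfRootsOfUnity_finset_sum (Aᶜ.disjSum B) (f := Sum.elim e f)
    (by rintro (i | i) -; exacts [he i, hf i]))
  rw [Finset.card_disjSum, Finset.card_compl, Fintype.card_fin] at h2
  have := Finset.card_le_univ A
  rw [Fintype.card_fin] at this
  omega

theorem minimal_of_no_common_term (he : ∀ i, IsOfFinOrder (e i)) (hf : ∀ i, IsOfFinOrder (f i))
    (h : ∑ i, e i = ∑ i, f i) (hmin : ∀ k, IsSumOfRootsOfUnity k (∑ i, e i) → 3 ≤ k)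
    (hne : ∀ i j, f j ≠ e i) (s : Finset (Fin 3 ⊕ Fin 3))
    (hs : ∑ i ∈ s, Sum.elim e (fun j ↦ -f j) i = 0) : s = ∅ ∨ s = Finset.univ := by
  rw [← Finset.toLeft_disjSum_toRight (u := s), Finset.sum_disjSum] at hs
  simp only [Sum.elim_inl, Sum.elim_inr, Finset.sum_neg_distrib] at hs
  have hAB : ∑ i ∈ s.toLeft, e i = ∑ i ∈ s.toRight, f i := by linear_combination hs
  have hcard : s.toLeft.card = s.toRight.card :=
    le_antisymm (card_le_card_of_sum_eq_sum he hf hmin hAB)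
      (card_le_card_of_sum_eq_sum hf he (h ▸ hmin) hAB.symm)
  have hAB' : ∑ i ∈ s.toLeftᶜ, e i = ∑ i ∈ s.toRightᶜ, f i := by
    have h1 := Finset.sum_compl_add_sum s.toLeft e
    have h2 := Finset.sum_compl_add_sum s.toRight f
    linear_combination h1 - h2 + h - hAB
  have hcard' : s.toLeftᶜ.card = s.toRightᶜ.card := by
    rw [Finset.card_compl, Finset.card_compl, hcard]
  have no : ∀ A B : Finset (Fin 3), A.card = B.card → ∑ i ∈ A, e i = ∑ i ∈ B, f i →
      A.card ≠ 1 := by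
    intro A B hc hs hA
    obtain ⟨i, rfl⟩ := Finset.card_eq_one.1 hA
    obtain ⟨j, rfl⟩ := Finset.card_eq_one.1 (hc ▸ hA)
    rw [Finset.sum_singleton, Finset.sum_singleton] at hs
    exact hne i j hs.symm
  have h1 := no _ _ hcard hAB
  have h2 := no _ _ hcard' hAB'
  have h3 : s.toLeft.card ≤ 3 := by simpa using Finset.card_le_univ s.toLeft
  rw [Finset.card_compl, Fintype.card_fin] at h2
  have h4 : s.toLeft.card = 0 ∨ s.toLeft.card = 3 := by omega
  have hcs := Finset.card_toLeft_add_card_toRight (u := s)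
  rcases h4 with h4 | h4
  · left
    rw [← Finset.card_eq_zero]
    omega
  · right
    apply Finset.eq_univ_of_card
    rw [Fintype.card_sum, Fintype.card_fin]
    omega

/-- Two different representations of a sum of length three come from the vanishing sum
`-ω - ω² + ζ₅ + ζ₅² + ζ₅³ + ζ₅⁴`. -/
theorem range_subset_or_golden (he : ∀ i, IsOfFinOrder (e i)) (hf : ∀ i, IsOfFinOrder (f i))
    (h : ∑ i, e i = ∑ i, f i) (hmin : ∀ k, IsSumOfRootsOfUnity k (∑ i, e i) → 3 ≤ k) :
    (∀ j, ∃ i, f j = e i) ∨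
    ∃ (ε w : ℂ) (a b : Fin 3), IsOfFinOrder ε ∧ w ^ 2 + w + 1 = 0 ∧ e a = -(ε * w) ∧
      f b = ε * w ^ 2 ∧ (∀ i, i ≠ a → e i ^ 5 = ε ^ 5 ∧ e i ≠ ε) ∧
      (∀ i, i ≠ b → f i ^ 5 = -ε ^ 5) ∧ ∀ i j, i ≠ a → j ≠ a → e i = e j → i = j := by
  by_cases hcom : ∃ i j, f j = e i
  · obtain ⟨i, j, hij⟩ := hcom
    exact Or.inl (range_subset_of_common_term he hf h hmin hij)
  right
  push Not at hcom
  obtain ⟨ε, w, k, l, hε, hw, hkl, hk, hl, h5, hinj⟩ :=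
    exists_golden_of_minimal_vanishing (x := Sum.elim e (fun j ↦ -f j)) (by simp)
      (by rintro (i | i); exacts [he i, (hf i).neg_complex])
      (by simp [h]) (minimal_of_no_common_term he hf h hmin hcom)
  have hneg : ∀ z : ℂ, (-z) ^ 5 = ε ^ 5 → z ^ 5 = -ε ^ 5 := fun z hz ↦ by linear_combination -hz
  have hshort : ∀ z, IsOfFinOrder z → ∑ i, e i ≠ ε + z := fun z hz heq ↦ by
    have := hmin 2 (heq ▸ isSumOfRootsOfUnity_two hε hz)
    omega
  have hshort' : ∀ z, IsOfFinOrder z → ∑ i, e i ≠ -ε + z := fun z hz heq ↦ by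
    have := hmin 2 (heq ▸ isSumOfRootsOfUnity_two hε.neg_complex hz)
    omega
  rcases k with a | b <;> rcases l with a' | b' <;>
    simp only [Sum.elim_inl, Sum.elim_inr, neg_inj] at hk hl
  -- If both exceptional terms lie on one side, then -εω - εω² = ε shortens that side to two terms.
  · obtain ⟨c, -, -, -, hc⟩ := exists_sum_fin_three_eq a a' (by simpa using hkl)
    exact absurd (by rw [hc, hk, hl]; linear_combination -ε * hw) (hshort (e c) (he c))
  · refine ⟨ε, w, a, b', hε, hw, hk, hl, fun i hi ↦ ?_, fun i hi ↦ ?_, fun i j hi hj hij ↦ ?_⟩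
    · exact h5 (Sum.inl i) (by simpa using hi) (by simp)
    · exact hneg _ (h5 (Sum.inr i) (by simp) (by simpa using hi)).1
    · exact Sum.inl_injective (hinj (Sum.inl i) (Sum.inl j) (by simpa using hi) (by simp)
        (by simpa using hj) (by simp) hij)
  · refine ⟨ε, w ^ 2, a', b, hε, ?_, hl, ?_, fun i hi ↦ ?_, fun i hi ↦ ?_,
      fun i j hi hj hij ↦ ?_⟩
    · linear_combination (w ^ 2 - w + 1) * hw
    · rw [hk]
      linear_combination -ε * (w ^ 2 - w) * hw
    · exact h5 (Sum.inl i) (by simp) (by simpa using hi)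
    · exact hneg _ (h5 (Sum.inr i) (by simpa using hi) (by simp)).1
    · exact Sum.inl_injective (hinj (Sum.inl i) (Sum.inl j) (by simp) (by simpa using hi)
        (by simp) (by simpa using hj) hij)
  · obtain ⟨c, -, -, -, hc⟩ := exists_sum_fin_three_eq b b' (by simpa using hkl)
    exact absurd (by rw [h, hc, hk, hl]; linear_combination ε * hw) (hshort' (f c) (hf c))

end

/-! ### Groups acting on the three terms -/

theorem ncard_pair_le {X : Type*} (x y : X) : ({x, y} : Set X).ncard ≤ 2 := by
  simpa using Set.ncard_insert_le x {y}

theorem card_le_three_of_preserves_range {G X : Type*} [Group G] [Finite G] [MulAction G X]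
    (hcomm : ∀ σ τ : G, σ * τ = τ * σ) {E : Fin 3 → X}
    (hfaith : ∀ σ : G, (∀ i, σ • E i = E i) → σ = 1) (hE : ∀ (σ : G) i, ∃ j, σ • E i = E j) :
    Nat.card G ≤ 3 := by
  let Y : SubMulAction G X :=
    { carrier := Set.range E
      smul_mem' := by
        rintro σ _ ⟨i, rfl⟩
        obtain ⟨j, hj⟩ := hE σ i
        exact ⟨j, hj.symm⟩ }
  have hYfin : Finite Y := Set.finite_range E
  have hY3 : Nat.card Y ≤ 3 := by
    have := Nat.card_le_card_of_surjective (fun i ↦ (⟨E i, i, rfl⟩ : Y))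
      (by rintro ⟨_, i, rfl⟩; exact ⟨i, rfl⟩)
    simpa using this
  let f := MulAction.toPermHom G Y
  have hf : Function.Injective f := by
    rw [injective_iff_map_eq_one]
    intro σ hσ
    refine hfaith σ fun i ↦ ?_
    exact congrArg Subtype.val (Equiv.congr_fun hσ (⟨E i, i, rfl⟩ : Y))
  have hdvd := Subgroup.card_dvd_of_injective f hf
  rw [Nat.card_perm] at hdvd
  by_contra! hcon
  have hle := Nat.le_of_dvd (Nat.factorial_pos _) hdvd
  have hYc : Nat.card Y = 3 := by
    generalize Nat.card Y = n at *
    interval_cases n <;> simp_all [Nat.factorial]; omega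
  have hperm : Nat.card (Equiv.Perm Y) = 6 := by
    rw [Nat.card_perm, hYc]
    rfl
  have hG : Nat.card G = 6 := by
    rw [hYc] at hdvd hle
    change _ ∣ 6 at hdvd
    change _ ≤ 6 at hle
    generalize Nat.card G = n at *
    interval_cases n <;> revert hdvd <;> decide
  have hbij : Function.Bijective f :=
    hf.bijective_of_nat_card_le (by rw [hperm, hG])
  let e := (Finite.equivFinOfCardEq hYc).permCongrHom
  obtain ⟨σ, hσ⟩ := (e.surjective.comp hbij.2) (Equiv.swap 0 1)
  obtain ⟨τ, hτ⟩ := (e.surjective.comp hbij.2) (Equiv.swap 1 2)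
  have h1 : (Equiv.swap 0 1 : Equiv.Perm (Fin 3)) * Equiv.swap 1 2 =
      Equiv.swap 1 2 * Equiv.swap 0 1 := by
    rw [← hσ, ← hτ]
    simp only [Function.comp_apply, ← map_mul, hcomm σ τ]
  revert h1
  decide

section Golden

variable {G L : Type*} [Group G] [Field L] [CharZero L] [MulSemiringAction G L]
  {E : Fin 3 → L} {ε w : L} {a : Fin 3}

theorem cube_root_facts (hw : w ^ 2 + w + 1 = 0) : w ^ 3 = 1 ∧ w ≠ 0 ∧ w ≠ -1 ∧ w ≠ 1 := by
  refine ⟨by linear_combination (w - 1) * hw, ?_, ?_, ?_⟩ <;> rintro rfl <;> norm_num at hw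

/-- The fifth power of -εω is -ε⁵ω², which singles this term out from the other two. -/
theorem golden_pow_five_ne (hw : w ^ 2 + w + 1 = 0) (hε : ε ≠ 0) : (-(ε * w)) ^ 5 ≠ ε ^ 5 := by
  intro h
  obtain ⟨h3, h0, -, -⟩ := cube_root_facts hw
  have h1 : ε ^ 5 * w = 0 := by
    linear_combination h + ε ^ 5 * hw + ε ^ 5 * w ^ 2 * h3
  exact mul_ne_zero (pow_ne_zero 5 hε) h0 h1

theorem golden_injective (hw : w ^ 2 + w + 1 = 0) (hε : ε ≠ 0) (ha : E a = -(ε * w))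
    (h5 : ∀ i, i ≠ a → E i ^ 5 = ε ^ 5)
    (hinj : ∀ i j, i ≠ a → j ≠ a → E i = E j → i = j) : Function.Injective E := by
  have hne : ∀ i, i ≠ a → E i ≠ E a := fun i hi h ↦
    golden_pow_five_ne hw hε (by rw [← ha, ← h, h5 i hi])
  intro i j h
  by_cases hi : i = a
  · by_contra hij
    exact hne j (fun hj ↦ hij (hi.trans hj.symm)) (by rw [← h, hi])
  · by_cases hj : j = a
    · exact absurd (hj ▸ h) (hne i hi)
    · exact hinj i j hi hj h

theorem golden_smul_eq_of_preserves (hw : w ^ 2 + w + 1 = 0) (hε : ε ≠ 0) (ha : E a = -(ε * w))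
    (h5 : ∀ i, i ≠ a → E i ^ 5 = ε ^ 5)
    (hinj : ∀ i j, i ≠ a → j ≠ a → E i = E j → i = j) {σ : G}
    (hσ : ∀ i, ∃ j, σ • E i = E j) : σ • E a = E a := by
  have hE := golden_injective hw hε ha h5 hinj
  obtain ⟨j, hj⟩ := hσ a
  by_cases hja : j = a
  · rw [hj, hja]
  exfalso
  obtain ⟨c, hca⟩ := exists_ne a
  obtain ⟨d, hcd, had, -, -⟩ := exists_sum_fin_three_eq c a hca
  obtain ⟨p, hp⟩ := hσ c
  obtain ⟨q, hq⟩ := hσ d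
  have hpq : p ≠ q := fun h ↦ hcd (hE (MulAction.injective σ (by
    change σ • E c = σ • E d
    rw [hp, hq, h])))
  have hpj : p ≠ j := fun h ↦ hca (hE (MulAction.injective σ (by
    change σ • E c = σ • E a
    rw [hp, hj, h])))
  have hqj : q ≠ j := fun h ↦ had (hE (MulAction.injective σ (by
    change σ • E a = σ • E d
    rw [hq, hj, h])))
  have h : E p ^ 5 = E q ^ 5 := by
    rw [← hp, ← hq, ← smul_pow', ← smul_pow', h5 c hca, h5 d had.symm]
  have hcase : p = a ∨ q = a := by omega
  rcases hcase with rfl | rfl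
  · rw [h5 q hpq.symm, ha] at h
    exact golden_pow_five_ne hw hε h
  · rw [h5 p hpq, ha] at h
    exact golden_pow_five_ne hw hε h.symm

variable [Finite G]

theorem golden_card_le_four (hfaith : ∀ σ : G, (∀ i, σ • E i = E i) → σ = 1)
    (hw : w ^ 2 + w + 1 = 0) (hε : ε ≠ 0)
    (ha : E a = -(ε * w)) (h5 : ∀ i, i ≠ a → E i ^ 5 = ε ^ 5)
    (hinj : ∀ i j, i ≠ a → j ≠ a → E i = E j → i = j)
    (hσ : ∀ σ : G, (∀ i, ∃ j, σ • E i = E j) ∨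
      (σ • E a = ε * w ^ 2 ∧ ∀ i, i ≠ a → (σ • E i) ^ 5 = -ε ^ 5)) :
    Nat.card G ≤ 4 ∧ (Nat.card G = 4 → ∃ (σ τ : G) (c d : Fin 3), c ≠ a ∧ d ≠ a ∧ c ≠ d ∧
      σ • E a = E a ∧ σ • E c = E d ∧ σ • E d = E c ∧ τ • E a = ε * w ^ 2 ∧
      ∀ i, i ≠ a → (τ • E i) ^ 5 = -ε ^ 5) := by
  have hE := golden_injective hw hε ha h5 hinj
  obtain ⟨h3, h0, hm1, -⟩ := cube_root_facts hw
  obtain ⟨c, hca⟩ := exists_ne a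
  obtain ⟨d, hcd, had, hall, -⟩ := exists_sum_fin_three_eq c a hca
  have hEa : E a ≠ ε * w ^ 2 := by
    intro h
    have h1 : ε * w * (w + 1) = 0 := by linear_combination ha - h
    rcases mul_eq_zero.1 h1 with h1 | h1
    · exact mul_ne_zero hε h0 h1
    · exact hm1 (eq_neg_of_add_eq_zero_left h1)
  -- Orbit and stabilizer of the exceptional term have at most two elements each.
  set S := MulAction.stabilizer G (E a) with hS
  have horb : S.index ≤ 2 := by
    rw [hS, MulAction.index_stabilizer]
    refine (Set.ncard_le_ncard (t := {E a, ε * w ^ 2}) ?_ (by simp)).trans (ncard_pair_le ..)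
    rintro _ ⟨σ, rfl⟩
    rcases hσ σ with h | h
    · exact Or.inl (golden_smul_eq_of_preserves hw hε ha h5 hinj h)
    · exact Or.inr h.1
  have hcd' : ∀ σ ∈ S, (σ • E c = E c ∧ σ • E d = E d) ∨ (σ • E c = E d ∧ σ • E d = E c) := by
    intro σ hs
    have hfix : σ • E a = E a := hs
    have h := (hσ σ).resolve_right fun h ↦ hEa (hfix.symm.trans h.1)
    obtain ⟨p, hp⟩ := h c
    obtain ⟨q, hq⟩ := h d
    have hpq : p ≠ q := fun h ↦ hcd (hE (MulAction.injective σ (by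
      change σ • E c = σ • E d
      rw [hp, hq, h])))
    have hpa : p ≠ a := fun h ↦ hca (hE (MulAction.injective σ (by
      change σ • E c = σ • E a
      rw [hp, hfix, h])))
    have hqa : q ≠ a := fun h ↦ had (hE (MulAction.injective σ (by
      change σ • E a = σ • E d
      rw [hq, hfix, h])))
    rcases hall p with rfl | rfl | rfl
    · rcases hall q with rfl | rfl | rfl
      · exact absurd rfl hpq
      · exact absurd rfl hqa
      · exact Or.inl ⟨hp, hq⟩
    · exact absurd rfl hpa
    · rcases hall q with rfl | rfl | rfl
      · exact Or.inr ⟨hp, hq⟩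
      · exact absurd rfl hqa
      · exact absurd rfl hpq
  have hScard : Nat.card S ≤ 2 := by
    have hmem : ∀ σ : S, (σ : G) • E c ∈ ({E c, E d} : Set L) := fun σ ↦ by
      rcases hcd' σ σ.2 with h | h
      · exact Or.inl h.1
      · exact Or.inr h.1
    have hi : Function.Injective (fun σ : S ↦ (⟨(σ : G) • E c, hmem σ⟩ : ({E c, E d} : Set L))) := by
      intro σ τ h
      have h1 : (σ : G) • E c = (τ : G) • E c := congrArg Subtype.val h
      have h2 : (σ : G) • E d = (τ : G) • E d := by
        have hne : E c ≠ E d := fun h ↦ hcd (hE h)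
        rcases hcd' σ σ.2 with h | h <;> rcases hcd' τ τ.2 with h' | h' <;>
          simp_all
      have h3 : (σ : G) • E a = (τ : G) • E a :=
        (show (σ : G) • E a = E a from σ.2).trans (show (τ : G) • E a = E a from τ.2).symm
      have h4 : (τ : G)⁻¹ * σ = 1 := hfaith _ fun i ↦ by
        rw [mul_smul, inv_smul_eq_iff]
        rcases hall i with rfl | rfl | rfl
        exacts [h1, h3, h2]
      exact Subtype.ext (inv_mul_eq_one.1 h4).symm
    have := Nat.card_le_card_of_injective _ hi
    rw [Nat.card_coe_set_eq] at this
    exact this.trans (ncard_pair_le ..)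
  have hmul := S.card_mul_index
  refine ⟨by nlinarith, fun h4 ↦ ?_⟩
  have hS2 : Nat.card S = 2 := by nlinarith
  have hind : S.index = 2 := by nlinarith
  obtain ⟨σ, hs, hσ1⟩ : ∃ σ ∈ S, σ ≠ 1 := by
    have : Nontrivial S := Finite.one_lt_card_iff_nontrivial.1 (by omega)
    obtain ⟨σ, h⟩ := exists_ne (1 : S)
    exact ⟨σ, σ.2, fun h1 ↦ h (Subtype.ext h1)⟩
  obtain ⟨τ, hτ⟩ : ∃ τ, τ ∉ S := by
    by_contra! hcon
    rw [(Subgroup.eq_top_iff' S).2 hcon, Subgroup.index_top] at hind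
    omega
  have hτ' := (hσ τ).resolve_left fun h ↦
    hτ (golden_smul_eq_of_preserves hw hε ha h5 hinj h)
  rcases hcd' σ hs with h | h
  · refine absurd (hfaith σ fun i ↦ ?_) hσ1
    rcases hall i with rfl | rfl | rfl
    exacts [h.1, hs, h.2]
  · exact ⟨σ, τ, c, d, hca, had.symm, hcd, hs, h.1, h.2, hτ'⟩

end Golden

theorem pow_three_ne_one_of_pow_five {L : Type*} [Field L] {z : L} (h5 : z ^ 5 = 1) (h1 : z ≠ 1) :
    z ^ 3 ≠ 1 := fun h3 ↦ h1 (by linear_combination (z ^ 3 + 1) * h3 - z * h5)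

section Golden

variable {G L : Type*} [Group G] [Field L] [CharZero L] [MulSemiringAction G L] {ε w : L} {σ τ : G}

/-- Since ω = (x / y)^10 = (x / y')^10, the swap fixes ω and hence ε. It sends z to some z^i with i²
≡ 1 mod 5, and i = 1 is excluded. -/
theorem golden_swap {x y y' : L} (hw : w ^ 2 + w + 1 = 0) (hε : ε ≠ 0) (hx : x = -(ε * w))
    (hy : y ^ 5 = ε ^ 5) (hy' : y' ^ 5 = ε ^ 5) (hy1 : y ≠ ε) (hy1' : y' ≠ ε) (hne : y ≠ y')
    (hσx : σ • x = x) (hσy : σ • y = y') (hσy' : σ • y' = y) :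
    ∃ z : L, z ^ 5 = 1 ∧ z ≠ 1 ∧ y = ε * z ∧ y' = ε * z ^ 4 ∧ σ • ε = ε ∧ σ • z = z ^ 4 := by
  obtain ⟨h3, h0, -, -⟩ := cube_root_facts hw
  have e1 : w * ε ^ 10 = x ^ 10 := by
    rw [hx]
    linear_combination -(ε ^ 10 * w * (w ^ 6 + w ^ 3 + 1)) * h3
  have e2 : w * y ^ 10 = x ^ 10 := by linear_combination e1 + w * (y ^ 5 + ε ^ 5) * hy
  have e3 : w * y' ^ 10 = x ^ 10 := by linear_combination e1 + w * (y' ^ 5 + ε ^ 5) * hy'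
  have hσw : σ • w = w := by
    have := congrArg (σ • ·) e2
    simp only [smul_mul', smul_pow', hσx, hσy] at this
    have hy0 : y' ^ 10 ≠ 0 := by
      rw [show y' ^ 10 = (y' ^ 5) ^ 2 by ring, hy']
      exact pow_ne_zero _ (pow_ne_zero _ hε)
    exact mul_right_cancel₀ hy0 (this.trans e3.symm)
  have hσε : σ • ε = ε := by
    rw [hx, smul_neg, smul_mul', hσw] at hσx
    exact mul_right_cancel₀ h0 (neg_inj.1 hσx)
  have hz5 : (y / ε) ^ 5 = 1 := by rw [div_pow, hy, div_self (pow_ne_zero 5 hε)]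
  have hz5' : (y' / ε) ^ 5 = 1 := by rw [div_pow, hy', div_self (pow_ne_zero 5 hε)]
  have hz1 : y / ε ≠ 1 := fun h ↦ hy1 ((div_eq_one_iff_eq hε).1 h)
  have hz1' : y' / ε ≠ 1 := fun h ↦ hy1' ((div_eq_one_iff_eq hε).1 h)
  have hzne : y / ε ≠ y' / ε := fun h ↦ hne ((div_left_inj' hε).1 h)
  have hσz : σ • (y / ε) = y' / ε := by rw [div_eq_mul_inv, smul_mul', smul_inv'', hσy, hσε, ← div_eq_mul_inv]
  have hσz' : σ • (y' / ε) = y / ε := by rw [div_eq_mul_inv, smul_mul', smul_inv'', hσy', hσε, ← div_eq_mul_inv]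
  have hey : y = ε * (y / ε) := by field_simp
  have hey' : y' = ε * (y' / ε) := by field_simp
  generalize y / ε = z at *
  generalize y' / ε = z' at *
  have hz3 := pow_three_ne_one_of_pow_five hz5 hz1
  have hz0 : z ≠ 0 := by
    rintro rfl
    norm_num at hz5
  have hprim : IsPrimitiveRoot z 5 :=
    IsPrimitiveRoot.iff_orderOf.2 (orderOf_eq_prime (hp := ⟨Nat.prime_five⟩) hz5 hz1)
  have hz4 : z' = z ^ 4 := by
    obtain ⟨i, hi, rfl⟩ := hprim.eq_pow_of_pow_eq_one hz5'
    rw [smul_pow', hσz] at hσz'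
    interval_cases i
    · simp at hz1'
    · simp at hzne
    · exact absurd (mul_right_cancel₀ hz0 (by linear_combination hσz')) hz3
    · exact absurd (mul_right_cancel₀ hz0 (by linear_combination hσz' - z ^ 4 * hz5)) hz3
    · rfl
  exact ⟨z, hz5, hz1, hey, hz4 ▸ hey', hσε, hσz.trans hz4⟩

theorem golden_reflect {x y : L} (hw : w ^ 2 + w + 1 = 0) (hε : ε ≠ 0) (hx : x = -(ε * w))
    (hy : y ^ 5 = ε ^ 5) (hτx : τ • x = ε * w ^ 2) (hτy : (τ • y) ^ 5 = -ε ^ 5) :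
    τ • ε = -ε ∧ τ • w = w ^ 2 := by
  obtain ⟨h3, h0, -, -⟩ := cube_root_facts hw
  have hε10 : ε ^ 10 ≠ 0 := pow_ne_zero _ hε
  have e2 : w * y ^ 10 = x ^ 10 := by
    rw [hx]
    linear_combination w * (y ^ 5 + ε ^ 5) * hy - (ε ^ 10 * w * (w ^ 6 + w ^ 3 + 1)) * h3
  have hτw : τ • w = w ^ 2 := by
    have := congrArg (τ • ·) e2
    simp only [smul_mul', smul_pow', hτx] at this
    apply mul_right_cancel₀ hε10
    linear_combination this - (τ • w) * ((τ • y) ^ 5 - ε ^ 5) * hτy + ε ^ 10 * w ^ 2 *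
      (w ^ 15 + w ^ 12 + w ^ 9 + w ^ 6 + w ^ 3 + 1) * h3
  refine ⟨?_, hτw⟩
  rw [hx, smul_neg, smul_mul', hτw] at hτx
  exact mul_right_cancel₀ (pow_ne_zero 2 h0) (by linear_combination -hτx)

/-- τ multiplies ε^n by (-1)^n. As it fixes 1 and -1, both the order of ε and its half are even. -/
theorem four_dvd_orderOf_of_smul_eq_neg (hε : IsOfFinOrder ε) (hτ : τ • ε = -ε) :
    4 ∣ orderOf ε := by
  have hone : (-1 : L) ≠ 1 := by
    intro h
    have : (2 : L) = 0 := by linear_combination -h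
    exact two_ne_zero this
  have hpow : ∀ n, τ • (ε ^ n) = (-1) ^ n * ε ^ n := fun n ↦ by
    rw [smul_pow', hτ, neg_pow]
  have hεN := pow_orderOf_eq_one ε
  have heven : Even (orderOf ε) := by
    by_contra ho
    have := hpow (orderOf ε)
    rw [hεN, smul_one, (Nat.not_even_iff_odd.1 ho).neg_one_pow, mul_one] at this
    exact hone this.symm
  obtain ⟨k, hk⟩ := heven.two_dvd
  have hkpos : 0 < k := by
    have := hε.orderOf_pos
    omega
  have hεk : ε ^ k = -1 := by
    have h2 : (ε ^ k) ^ 2 = 1 := by rw [← pow_mul, mul_comm, ← hk, hεN]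
    refine (_root_.sq_eq_one_iff.1 h2).resolve_left ?_
    exact pow_ne_one_of_lt_orderOf hkpos.ne' (by omega)
  have hkeven : Even k := by
    by_contra ho
    have := hpow k
    rw [hεk, smul_neg, smul_one, (Nat.not_even_iff_odd.1 ho).neg_one_pow] at this
    exact hone (by linear_combination this)
  obtain ⟨j, hj⟩ := hkeven.two_dvd
  exact ⟨j, by omega⟩

/-- Otherwise a primitive cube root of unity would be an even power of ε and so fixed by τ. -/
theorem not_three_dvd_orderOf (hε : IsOfFinOrder ε) (hw : w ^ 2 + w + 1 = 0) (hτ : τ • ε = -ε)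
    (hτw : τ • w = w ^ 2) : ¬ 3 ∣ orderOf ε := by
  rintro ⟨k, hk⟩
  obtain ⟨h3, h0, -, h1⟩ := cube_root_facts hw
  have hkpos : 0 < k := by
    have := hε.orderOf_pos
    omega
  have hkeven : Even k := by
    obtain ⟨j, hj⟩ := four_dvd_orderOf_of_smul_eq_neg hε hτ
    exact ⟨k / 2, by omega⟩
  have hτu : τ • (ε ^ k) = ε ^ k := by rw [smul_pow', hτ, hkeven.neg_pow]
  have hu3 : (ε ^ k) ^ 3 = 1 := by rw [← pow_mul, mul_comm, ← hk, pow_orderOf_eq_one]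
  have hu1 : ε ^ k ≠ 1 := pow_ne_one_of_lt_orderOf hkpos.ne' (by omega)
  generalize ε ^ k = u at *
  have hu : u ^ 2 + u + 1 = 0 :=
    mul_left_cancel₀ (sub_ne_zero.2 hu1) (by linear_combination hu3)
  have hww : w ^ 2 ≠ w := fun h ↦ h1 (mul_left_cancel₀ h0 (by linear_combination h))
  have h : (u - w) * (u - w ^ 2) = 0 := by linear_combination hu - u * hw + h3
  rcases mul_eq_zero.1 h with h | h
  · rw [sub_eq_zero.1 h, hτw] at hτu
    exact hww hτu
  · rw [sub_eq_zero.1 h, smul_pow', hτw] at hτu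
    exact hww (by linear_combination -hτu + w * h3)

/-- Otherwise z would be a power of ε and so fixed by σ. -/
theorem not_five_dvd_orderOf {z : L} (hε : IsOfFinOrder ε) (hz5 : z ^ 5 = 1) (hz1 : z ≠ 1)
    (hσ : σ • ε = ε) (hσz : σ • z = z ^ 4) : ¬ 5 ∣ orderOf ε := by
  rintro ⟨k, hk⟩
  have hu : IsPrimitiveRoot (ε ^ k) 5 :=
    (IsPrimitiveRoot.orderOf ε).pow hε.orderOf_pos (by rw [hk, mul_comm])
  obtain ⟨i, -, hi⟩ := hu.eq_pow_of_pow_eq_one hz5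
  have h : σ • z = z := by rw [← hi, smul_pow', smul_pow', hσ]
  rw [hσz] at h
  have hz0 : z ≠ 0 := by
    rintro rfl
    norm_num at hz5
  exact pow_three_ne_one_of_pow_five hz5 hz1
    (mul_right_cancel₀ hz0 (by linear_combination h))

end Golden

/-! ### Uniqueness of the parameters and the explicit form -/

/-- Fifth powers identify the exceptional index. Then ε⁵ is known, and so is ε³ = (εω)³, hence ε.
This lets one pair ε, ω serve all automorphisms. -/
theorem golden_unique {e : Fin 3 → ℂ} {ε ε' w w' : ℂ} {a a' : Fin 3} (hw : w ^ 2 + w + 1 = 0)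
    (hw' : w' ^ 2 + w' + 1 = 0) (hε : ε ≠ 0) (hε' : ε' ≠ 0) (ha : e a = -(ε * w))
    (ha' : e a' = -(ε' * w')) (h5 : ∀ i, i ≠ a → e i ^ 5 = ε ^ 5)
    (h5' : ∀ i, i ≠ a' → e i ^ 5 = ε' ^ 5) : a' = a ∧ ε' = ε ∧ w' = w := by
  have haa : a' = a := by
    by_contra hne
    obtain ⟨c, h1, h2, -, -⟩ := exists_sum_fin_three_eq a a' (Ne.symm hne)
    have h3 : ε ^ 5 = ε' ^ 5 := (h5 c h1.symm).symm.trans (h5' c h2.symm)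
    exact golden_pow_five_ne hw' hε' (by rw [← ha', h5 a' hne, h3])
  subst haa
  obtain ⟨c, hc⟩ := exists_ne a'
  have h3 : ε ^ 5 = ε' ^ 5 := (h5 c hc).symm.trans (h5' c hc)
  have h4 : ε * w = ε' * w' := neg_inj.1 (ha.symm.trans ha')
  obtain ⟨hw3, hw0, -, -⟩ := cube_root_facts hw
  obtain ⟨hw3', -, -, -⟩ := cube_root_facts hw'
  have h6 : ε ^ 3 = ε' ^ 3 := by
    have := congrArg (· ^ 3) h4
    simpa only [mul_pow, hw3, hw3', mul_one] using this
  have hεε : ε' = ε := by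
    apply mul_right_cancel₀ (pow_ne_zero 5 hε)
    linear_combination ε' * h3 - (ε ^ 3 + ε' ^ 3) * h6
  refine ⟨rfl, hεε, ?_⟩
  rw [hεε] at h4
  exact (mul_left_cancel₀ hε h4).symm

theorem isPrimitiveRoot_neg_six {w : ℂ} (hw : w ^ 2 + w + 1 = 0) : IsPrimitiveRoot (-w) 6 := by
  obtain ⟨h3, h0, hm1, h1⟩ := cube_root_facts hw
  rw [IsPrimitiveRoot.iff_orderOf]
  refine orderOf_eq_of_pow_and_pow_div_prime (by norm_num)
    (by linear_combination (w ^ 3 + 1) * h3) fun p hp hd ↦ ?_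
  have hle := Nat.le_of_dvd (by norm_num) hd
  interval_cases p
  · exact absurd hp (by norm_num)
  · exact absurd hp (by norm_num)
  · norm_num
    intro h
    have h2 : (2 : ℂ) = 0 := by linear_combination -h - h3
    exact two_ne_zero h2
  · norm_num
    exact ⟨h1, hm1⟩
  · omega
  · omega
  · exact absurd hp (by norm_num)

theorem exists_golden_form {α ε w z : ℂ} (hε : IsOfFinOrder ε) (hw : w ^ 2 + w + 1 = 0)
    (hz5 : z ^ 5 = 1) (hz1 : z ≠ 1) (h4 : 4 ∣ orderOf ε) (h3 : ¬ 3 ∣ orderOf ε)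
    (h5 : ¬ 5 ∣ orderOf ε) (hα : α = -(ε * w) + ε * z + ε * z ^ 4) :
    ∃ (ε : ℂ) (c a : ℕ), IsOfFinOrder ε ∧ 4 ∣ orderOf ε ∧ ¬ 3 ∣ orderOf ε ∧
      ¬ 5 ∣ orderOf ε ∧ Nat.Coprime c 6 ∧ Nat.Coprime a 5 ∧
      α = ε * (zetaRoot 6 ^ c + zetaRoot 5 ^ a + zetaRoot 5 ^ (4 * a)) := by
  have hprim : IsPrimitiveRoot z 5 :=
    IsPrimitiveRoot.iff_orderOf.2 (orderOf_eq_prime (hp := ⟨Nat.prime_five⟩) hz5 hz1)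
  obtain ⟨c, -, hc, hc'⟩ := ((zetaRoot_isPrimitiveRoot (n := 6) (by norm_num)).isPrimitiveRoot_iff).1 (isPrimitiveRoot_neg_six hw)
  obtain ⟨a, -, ha, ha'⟩ := ((zetaRoot_isPrimitiveRoot (n := 5) (by norm_num)).isPrimitiveRoot_iff).1 hprim
  refine ⟨ε, c, a, hε, h4, h3, h5, hc, ha, ?_⟩
  rw [mul_comm 4 a, pow_mul, hc', ha', hα]
  ring

/-! ### The Galois group of ℚ_m over ℚ(α) -/

/-- The Galois group of `ℚ_m`, with the algebra structure of an intermediate field. -/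
abbrev CycGal (m : ℕ) : Type :=
  @AlgEquiv ℚ (cycField m) (cycField m) _ _ _ (cycField m).algebra' (cycField m).algebra'

/-- The group of automorphisms of `ℚ_m` that fix `ℚ(α) ∩ ℚ_m`. -/
noncomputable abbrev cycStabilizer (m : ℕ) (α : ℂ) : Subgroup (CycGal m) :=
  ((adjoin ℚ {α}).comap (cycField m).val).fixingSubgroup

theorem relfinrank_cycField {m : ℕ} (hm : 0 < m) (α : ℂ) :
    relfinrank (adjoin ℚ {α}) (cycField m) = Nat.card (cycStabilizer m α) := by
  have : NeZero m := ⟨hm.ne'⟩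
  have := cycField_isCyclotomicExtension hm
  have h1 : FiniteDimensional ℚ (cycField m) := IsCyclotomicExtension.finiteDimensional {m} ℚ _
  have h2 : IsGalois ℚ (cycField m) := IsCyclotomicExtension.isGalois {m} ℚ _
  have h3 := @IsGalois.card_fixingSubgroup_eq_finrank ℚ _ (cycField m) _ (cycField m).algebra'
    ((adjoin ℚ {α}).comap (cycField m).val) h1 h2
  rw [h3, finrank_comap, fieldRange_val]

theorem cycField_aut_comm {m : ℕ} (hm : 0 < m) (σ τ : CycGal m) :
    σ * τ = τ * σ := by
  have : NeZero m := ⟨hm.ne'⟩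
  have := cycField_isCyclotomicExtension hm
  have h : ∀ σ τ : cycField m ≃ₐ[ℚ] cycField m, σ * τ = τ * σ := fun σ τ ↦ by
    apply (IsCyclotomicExtension.autEquivPow (cycField m)
      (Polynomial.cyclotomic.irreducible_rat hm)).injective
    rw [map_mul, map_mul, mul_comm]
  exact h σ τ

theorem finite_cycField_aut {m : ℕ} (hm : 0 < m) : Finite (CycGal m) := by
  have : NeZero m := ⟨hm.ne'⟩
  have := cycField_isCyclotomicExtension hm
  have : FiniteDimensional ℚ (cycField m) := IsCyclotomicExtension.finiteDimensional {m} ℚ _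
  infer_instance

theorem mem_cycStabilizer_iff {m : ℕ} {A : cycField m} {σ : CycGal m} :
    σ ∈ cycStabilizer m (A : ℂ) ↔ σ A = A := by
  refine (IntermediateField.mem_fixingSubgroup_iff _ _).trans ?_
  constructor
  · intro h
    exact h A (mem_adjoin_simple_self ℚ (A : ℂ))
  · intro h x hx
    have hle : adjoin ℚ {(A : ℂ)} ≤ cycField m := adjoin_simple_le_iff.2 A.2
    have hext : ((cycField m).val.comp σ.toAlgHom).comp (inclusion hle) =
        (adjoin ℚ {(A : ℂ)}).val := by
      refine adjoin_algHom_ext ℚ fun y hy ↦ ?_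
      obtain rfl : y = (A : ℂ) := hy
      exact congrArg Subtype.val h
    exact Subtype.ext (DFunLike.congr_fun hext (⟨(x : ℂ), hx⟩ : adjoin ℚ {(A : ℂ)}))

theorem cycField_aut_eq_one {m : ℕ} {e : Fin 3 → ℂ} (hle : cycField m = adjoin ℚ (Set.range e))
    {E : Fin 3 → cycField m} (hE : ∀ i, (E i : ℂ) = e i) {σ : CycGal m}
    (h : ∀ i, σ (E i) = E i) : σ = 1 := by
  have hext : (cycField m).val.comp σ.toAlgHom = (cycField m).val := by
    refine algHom_ext_of_eq_adjoin ℚ hle fun y hy ↦ ?_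
    obtain ⟨i, rfl⟩ := hy
    have h1 : (⟨e i, hle.ge (subset_adjoin _ _ ⟨i, rfl⟩)⟩ : cycField m) = E i :=
      Subtype.ext (hE i).symm
    rw [h1]
    exact congrArg Subtype.val (h i)
  ext x
  exact DFunLike.congr_fun hext x

/-- A representation of a sum of length three generates the cyclotomic field of its conductor. -/
theorem exists_cycField_eq_adjoin {α : ℂ} {e : Fin 3 → ℂ} (he : ∀ i, IsOfFinOrder (e i))
    (hsum : ∑ i, e i = α) (hmin : ∀ k, IsSumOfRootsOfUnity k α → 3 ≤ k) :
    ∃ m, 0 < m ∧ (∀ k, (∀ i, e i ^ k = 1) ↔ m ∣ k) ∧ cycField (cycConductor α) = cycField m ∧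
      cycField m = adjoin ℚ (Set.range e) := by
  obtain ⟨m, hm, hk, hle⟩ := exists_lcm_orders he
  refine ⟨m, hm, hk, cycField_cycConductor_eq he hsum (by simpa using hmin) hm hk,
    le_antisymm hle (adjoin_le_iff.2 ?_)⟩
  rintro _ ⟨i, rfl⟩
  exact mem_cycField_of_pow_eq_one hm ((hk m).2 dvd_rfl i)

/-! ### The bound and the case of equality -/

theorem relfinrank_le_four_and_form {α : ℂ} {e : Fin 3 → ℂ} (he : ∀ i, IsOfFinOrder (e i))
    (hsum : ∑ i, e i = α) (hmin : ∀ k, IsSumOfRootsOfUnity k α → 3 ≤ k) :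
    relfinrank (adjoin ℚ {α}) (cycField (cycConductor α)) ≤ 4 ∧
    (relfinrank (adjoin ℚ {α}) (cycField (cycConductor α)) = 4 →
      ∃ (ε : ℂ) (c a : ℕ), IsOfFinOrder ε ∧ 4 ∣ orderOf ε ∧ ¬ 3 ∣ orderOf ε ∧
        ¬ 5 ∣ orderOf ε ∧ Nat.Coprime c 6 ∧ Nat.Coprime a 5 ∧
        α = ε * (zetaRoot 6 ^ c + zetaRoot 5 ^ a + zetaRoot 5 ^ (4 * a))) := by
  obtain ⟨m, hm, hk, hcond, hadj⟩ := exists_cycField_eq_adjoin he hsum hmin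
  rw [hcond, relfinrank_cycField hm]
  have := finite_cycField_aut hm
  let E : Fin 3 → cycField m := fun i ↦
    ⟨e i, mem_cycField_of_pow_eq_one hm ((hk m).2 dvd_rfl i)⟩
  have hE : ∀ i, (E i : ℂ) = e i := fun i ↦ rfl
  clear_value E
  have hEα : ((∑ i, E i : cycField m) : ℂ) = α := by
    rw [← hsum]
    push_cast
    simp only [hE]
  have hcomm : ∀ σ τ : cycStabilizer m α, σ * τ = τ * σ := fun σ τ ↦
    Subtype.ext (cycField_aut_comm hm _ _)
  have hfaith : ∀ σ : cycStabilizer m α, (∀ i, σ • E i = E i) → σ = 1 := fun σ h ↦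
    Subtype.ext (cycField_aut_eq_one hadj hE h)
  have hfix : ∀ σ : cycStabilizer m α, ∑ i, ((σ • E i : cycField m) : ℂ) = α := fun σ ↦ by
    have h1 : (σ : CycGal m) (∑ i, E i) = ∑ i, E i :=
      mem_cycStabilizer_iff.1 (hEα.symm ▸ σ.2)
    rw [map_sum] at h1
    have h2 := (congrArg Subtype.val h1).trans hEα
    push_cast at h2
    exact h2
  have hσfin : ∀ (σ : cycStabilizer m α) i, IsOfFinOrder ((σ • E i : cycField m) : ℂ) := by
    intro σ i
    refine isOfFinOrder_iff_pow_eq_one.2 ⟨m, hm, ?_⟩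
    have h1 : E i ^ m = 1 := Subtype.ext (by
      push_cast
      rw [hE]
      exact (hk m).2 dvd_rfl i)
    have h2 : (σ • E i) ^ m = 1 := by rw [← smul_pow', h1, smul_one]
    simpa using congrArg Subtype.val h2
  have hdich := fun σ : cycStabilizer m α ↦ range_subset_or_golden he (hσfin σ)
    (hsum.trans (hfix σ).symm) (by rwa [hsum])
  have hpres : ∀ σ : cycStabilizer m α, (∀ i, ∃ j, ((σ • E i : cycField m) : ℂ) = e j) →
      ∀ i, ∃ j, σ • E i = E j := fun σ h i ↦ by
    obtain ⟨j, hj⟩ := h i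
    exact ⟨j, Subtype.ext (hj.trans (hE j).symm)⟩
  by_cases hall : ∀ σ : cycStabilizer m α, ∀ i, ∃ j, ((σ • E i : cycField m) : ℂ) = e j
  · have := card_le_three_of_preserves_range hcomm hfaith fun σ ↦ hpres σ (hall σ)
    exact ⟨by omega, by omega⟩
  rw [not_forall] at hall
  obtain ⟨σ₀, hσ₀⟩ := hall
  obtain ⟨ε, w, a, -, hεfin, hw, ha, -, h5, -, hinj⟩ := (hdich σ₀).resolve_left hσ₀
  have hε : ε ≠ 0 := hεfin.isUnit.ne_zero
  obtain ⟨hw3, hw0, -, -⟩ := cube_root_facts hw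
  obtain ⟨ε', hε'⟩ : ∃ ε' : cycField m, (ε' : ℂ) = ε := by
    obtain ⟨c, hc⟩ := exists_ne a
    have hec : e c ≠ 0 := (he c).isUnit.ne_zero
    have hea : e a ≠ 0 := (he a).isUnit.ne_zero
    -- Here -e a = εω, while (e c / e a)^10 = ω⁻¹.
    refine ⟨-E a * (E c ^ 10 / E a ^ 10), ?_⟩
    push_cast
    rw [hE, hE, show e c ^ 10 = (e c ^ 5) ^ 2 by ring, (h5 c hc).1, ha]
    have hw10 : (-(ε * w)) ^ 10 = ε ^ 10 * w := by
      linear_combination (ε ^ 10 * w * (w ^ 6 + w ^ 3 + 1)) * hw3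
    rw [hw10]
    field_simp
  obtain ⟨w', hw'⟩ : ∃ w' : cycField m, (w' : ℂ) = w := by
    refine ⟨-E a / ε', ?_⟩
    push_cast
    rw [hE, hε', ha]
    field_simp
  have hw'0 : w' ^ 2 + w' + 1 = 0 := Subtype.ext (by push_cast; rw [hw', hw])
  have hε'0 : ε' ≠ 0 := fun h ↦ hε (by rw [← hε', h]; rfl)
  have haE : E a = -(ε' * w') := Subtype.ext (by push_cast; rw [hE, hε', hw', ha])
  have h5E : ∀ i, i ≠ a → E i ^ 5 = ε' ^ 5 := fun i hi ↦
    Subtype.ext (by push_cast; rw [hE, hε', (h5 i hi).1])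
  have hneE : ∀ i, i ≠ a → E i ≠ ε' := fun i hi h ↦
    (h5 i hi).2 (by rw [← hE, h, hε'])
  have hinjE : ∀ i j, i ≠ a → j ≠ a → E i = E j → i = j := fun i j hi hj h ↦
    hinj i j hi hj (by rw [← hE, h, hE])
  have hσ : ∀ σ : cycStabilizer m α, (∀ i, ∃ j, σ • E i = E j) ∨
      (σ • E a = ε' * w' ^ 2 ∧ ∀ i, i ≠ a → (σ • E i) ^ 5 = -ε' ^ 5) := by
    intro σ
    rcases hdich σ with h | ⟨ε₁, w₁, a₁, b, hε₁, hw₁, ha₁, hb, h5₁, h5b, -⟩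
    · exact Or.inl (hpres σ h)
    · right
      obtain ⟨rfl, rfl, rfl⟩ := golden_unique hw hw₁ hε hε₁.isUnit.ne_zero ha ha₁
        (fun i hi ↦ (h5 i hi).1) (fun i hi ↦ (h5₁ i hi).1)
      have h5σ : ∀ i, i ≠ b → (σ • E i) ^ 5 = -ε' ^ 5 := fun i hi ↦
        Subtype.ext (by push_cast; rw [h5b i hi, hε'])
      -- Two of the images under σ have equal fifth powers, so the third is the image of the
      -- exceptional term.
      have hba : b = a₁ := by
        by_contra hne
        obtain ⟨k, hk1, hk2, -, -⟩ := exists_sum_fin_three_eq b a₁ hne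
        have h1 := (h5σ a₁ (Ne.symm hne)).trans (h5σ k hk1.symm).symm
        rw [← smul_pow', ← smul_pow'] at h1
        have h2 := (MulAction.injective σ h1).trans (h5E k hk2.symm)
        rw [haE] at h2
        exact golden_pow_five_ne hw'0 hε'0 h2
      subst hba
      exact ⟨Subtype.ext (by push_cast; rw [hb, hε', hw']), h5σ⟩
  obtain ⟨hle, hform⟩ := golden_card_le_four hfaith hw'0 hε'0 haE h5E hinjE hσ
  refine ⟨hle, fun h4 ↦ ?_⟩
  obtain ⟨σ, τ, c, d, hca, hda, hcd, hσa, hσc, hσd, hτa, hτ5⟩ := hform h4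
  obtain ⟨z, hz5, hz1, hc, hd, hσε, hσz⟩ := golden_swap hw'0 hε'0 haE (h5E c hca) (h5E d hda)
    (hneE c hca) (hneE d hda) (fun h ↦ hcd (hinjE c d hca hda h)) hσa hσc hσd
  obtain ⟨hτε, hτw⟩ := golden_reflect hw'0 hε'0 haE (h5E c hca) hτa (hτ5 c hca)
  have hord : orderOf ε' = orderOf ε := by
    rw [← hε']
    exact (orderOf_injective ((cycField m).val : cycField m →* ℂ) Subtype.val_injective ε').symm
  have hε'fin : IsOfFinOrder ε' := by
    rw [← orderOf_pos_iff, hord]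
    exact hεfin.orderOf_pos
  refine exists_golden_form (z := z) hεfin hw (by exact_mod_cast congrArg Subtype.val hz5)
    (fun h ↦ hz1 (Subtype.ext h)) (hord ▸ four_dvd_orderOf_of_smul_eq_neg hε'fin hτε)
    (hord ▸ not_three_dvd_orderOf hε'fin hw'0 hτε hτw)
    (hord ▸ not_five_dvd_orderOf hε'fin hz5 hz1 hσε hσz) ?_
  have hsum' : ∑ i, E i = E a + E c + E d := by
    obtain ⟨d', h1, h2, h3, h4⟩ := exists_sum_fin_three_eq a c hca.symm
    rcases h3 d with h | h | h
    · exact absurd h hda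
    · exact absurd h.symm hcd
    · apply Subtype.ext
      push_cast
      rw [h, h4 fun i ↦ (E i : ℂ)]
  rw [← hEα, hsum', haE, hc, hd]
  push_cast
  rw [hε', hw']

/-! ### The converse -/

/-- The exponent is chosen so that ε^t = -ε, ζ₆^t = ζ₆⁻¹ and ζ₅^t = ζ₅². It comes from t ≡ 2 mod 15,
with its parity read off modulo N. -/
theorem exists_golden_exponent {N : ℕ} (h4 : 4 ∣ N) (hN : 0 < N) (h3 : ¬ 3 ∣ N) (h5 : ¬ 5 ∣ N) :
    ∃ t, t.Coprime (15 * N) ∧ t ≡ 1 + N / 2 [MOD N] ∧ t % 6 = 5 ∧ t % 5 = 2 := by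
  obtain ⟨k, rfl⟩ := h4
  have hcop : Nat.Coprime (4 * k) 15 := by
    rw [show 15 = 3 * 5 by norm_num]
    exact Nat.Coprime.mul_right (((Nat.Prime.coprime_iff_not_dvd Nat.prime_three).2 h3).symm)
      (((Nat.Prime.coprime_iff_not_dvd Nat.prime_five).2 h5).symm)
  obtain ⟨t, ht1, ht2⟩ := Nat.chineseRemainder hcop (1 + 4 * k / 2) 2
  rw [show 4 * k / 2 = 2 * k by omega] at ht1 ⊢
  have hodd : t % 2 = 1 := by
    have := Nat.ModEq.of_dvd (show 2 ∣ 4 * k by omega) ht1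
    change t % 2 = (1 + 2 * k) % 2 at this
    omega
  change t % 15 = 2 % 15 at ht2
  refine ⟨t, Nat.Coprime.mul_right ?_ ?_, ht1, by omega, by omega⟩
  · have := Nat.ModEq.gcd_eq (show t ≡ 2 [MOD 15] from ht2)
    rw [Nat.Coprime, this]
    norm_num
  · rw [Nat.Coprime, ht1.gcd_eq]
    change Nat.Coprime _ _
    refine Nat.Coprime.mul_right ?_ (by simp)
    rw [show 4 = 2 ^ 2 by norm_num]
    exact Nat.Coprime.pow_right 2 (Nat.coprime_two_right.2 (by simp))

/-- The automorphism x ↦ x^t sends α to -ε(u⁻¹ + z² + z³), which is α because u + u⁻¹ = 1 and 1 + z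
+ z² + z³ + z⁴ = 0. Its square swaps εz and εz⁴, so its order is 4. -/
theorem four_dvd_relfinrank_of_form {α ε u z : ℂ} (hmin : ∀ k, IsSumOfRootsOfUnity k α → 3 ≤ k)
    (hε : IsOfFinOrder ε) (h4 : 4 ∣ orderOf ε) (h3 : ¬ 3 ∣ orderOf ε) (h5 : ¬ 5 ∣ orderOf ε)
    (hu : IsPrimitiveRoot u 6) (hz : IsPrimitiveRoot z 5) (hα : α = ε * (u + z + z ^ 4)) :
    4 ∣ relfinrank (adjoin ℚ {α}) (cycField (cycConductor α)) := by
  have hN := hε.orderOf_pos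
  have hεN := pow_orderOf_eq_one ε
  have hu6 := hu.pow_eq_one
  have hz5 := hz.pow_eq_one
  have hufin : IsOfFinOrder u := isOfFinOrder_iff_pow_eq_one.2 ⟨6, by norm_num, hu6⟩
  have hzfin : IsOfFinOrder z := isOfFinOrder_iff_pow_eq_one.2 ⟨5, by norm_num, hz5⟩
  obtain ⟨t, htcop, htN, ht6, ht5⟩ := exists_golden_exponent h4 hN h3 h5
  set e : Fin 3 → ℂ := ![ε * u, ε * z, ε * z ^ 4] with he_def
  have he : ∀ i, IsOfFinOrder (e i) := by
    intro i
    fin_cases i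
    exacts [hε.mul hufin, hε.mul hzfin, hε.mul hzfin.pow]
  have hsum : ∑ i, e i = α := by
    rw [Fin.sum_univ_three, hα]
    simp only [he_def, Matrix.cons_val]
    ring
  obtain ⟨m, hm, hk, hcond, hadj⟩ := exists_cycField_eq_adjoin he hsum hmin
  rw [hcond, relfinrank_cycField hm]
  have := finite_cycField_aut hm
  have hεt : ε ^ t = -ε := by
    have h1 : ε ^ (orderOf ε / 2) = -1 := by
      have h2 : (ε ^ (orderOf ε / 2)) ^ 2 = 1 := by
        rw [← pow_mul, show orderOf ε / 2 * 2 = orderOf ε by omega, hεN]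
      refine (_root_.sq_eq_one_iff.1 h2).resolve_left ?_
      exact pow_ne_one_of_lt_orderOf (by omega) (by omega)
    rw [pow_eq_pow_of_modEq htN hεN, pow_add, h1]
    ring
  have hut : u ^ t = u ^ 5 := pow_eq_pow_of_modEq (show t % 6 = 5 % 6 from ht6) hu6
  have hzt : z ^ t = z ^ 2 := pow_eq_pow_of_modEq (show t % 5 = 2 % 5 from ht5) hz5
  have hmd : m ∣ 15 * orderOf ε := (hk _).1 (by
    have h1 : ε ^ (15 * orderOf ε) = 1 := by rw [mul_comm, pow_mul, hεN, one_pow]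
    have h2 : u ^ (15 * orderOf ε) = 1 := by
      rw [show 15 * orderOf ε = 6 * (15 * orderOf ε / 6) by omega, pow_mul, hu6, one_pow]
    have h3 : z ^ (15 * orderOf ε) = 1 := by
      rw [show 15 * orderOf ε = 5 * (3 * orderOf ε) by ring, pow_mul, hz5, one_pow]
    intro i
    fin_cases i
    · simp [he_def, mul_pow, h1, h2]
    · simp [he_def, mul_pow, h1, h3]
    · simp [he_def, mul_pow, h1, h3, ← pow_mul, mul_comm 4, pow_mul z _ 4])
  obtain ⟨φ, hφ⟩ := exists_algEquiv_pow hm (htcop.coprime_dvd_right hmd)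
  let E : Fin 3 → cycField m := fun i ↦
    ⟨e i, mem_cycField_of_pow_eq_one hm ((hk m).2 dvd_rfl i)⟩
  have hE : ∀ i, (E i : ℂ) = e i := fun i ↦ rfl
  clear_value E
  have hEm : ∀ i, E i ^ m = 1 := fun i ↦ Subtype.ext (by
    push_cast
    rw [hE]
    exact (hk m).2 dvd_rfl i)
  have hφE : ∀ i, φ (E i) = E i ^ t := fun i ↦ hφ _ (hEm i)
  have hEα : ((∑ i, E i : cycField m) : ℂ) = α := by
    rw [← hsum]
    push_cast
    simp only [hE]
  have hsumu : u ^ 5 = 1 - u := by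
    have h1 : u ^ 3 = -1 := by
      have h2 : (u ^ 3) ^ 2 = 1 := by rw [← pow_mul, hu6]
      exact (_root_.sq_eq_one_iff.1 h2).resolve_left
        (hu.pow_ne_one_of_pos_of_lt (by norm_num) (by norm_num))
    have h2 : u + 1 ≠ 0 := fun h ↦ hu.pow_ne_one_of_pos_of_lt (l := 2) (by norm_num) (by norm_num)
      (by linear_combination (u - 1) * h)
    have h3 : u ^ 2 - u + 1 = 0 := mul_left_cancel₀ h2 (by linear_combination h1)
    linear_combination u ^ 2 * h1 - h3
  have hsumz : 1 + z + z ^ 2 + z ^ 3 + z ^ 4 = 0 := by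
    have := hz.geom_sum_eq_zero (by norm_num)
    simpa [Finset.sum_range_succ] using this
  have hφmem : φ ∈ cycStabilizer m α := by
    rw [← hEα]
    refine mem_cycStabilizer_iff.2 (((map_sum φ E Finset.univ).trans
      (Finset.sum_congr rfl fun i _ ↦ hφE i)).trans ?_)
    apply Subtype.ext
    rw [hEα]
    push_cast
    simp only [hE, Fin.sum_univ_three]
    have hz4t : (z ^ 4) ^ t = z ^ 8 := by rw [← pow_mul, mul_comm, pow_mul, hzt, ← pow_mul]
    simp only [he_def, Matrix.cons_val, mul_pow, hεt, hut, hzt, hz4t, hα]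
    linear_combination -ε * hsumu - ε * z ^ 3 * hz5 - ε * hsumz
  have hodd : Odd t := Nat.odd_iff.2 (by omega)
  have hφφ : ∀ i, φ (φ (E i)) = E i ^ (t * t) := fun i ↦ by
    rw [hφE, map_pow, hφE, ← pow_mul]
  have hεtt : ε ^ (t * t) = ε := by rw [pow_mul, hεt, hodd.neg_pow, hεt, neg_neg]
  have hutt : u ^ (t * t) = u := by
    rw [pow_mul, hut, ← pow_mul, mul_comm, pow_mul, hut]
    linear_combination u * (u ^ 18 + u ^ 12 + u ^ 6 + 1) * hu6
  have hztt : z ^ (t * t) = z ^ 4 := by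
    rw [pow_mul, hzt, ← pow_mul, mul_comm, pow_mul, hzt, ← pow_mul]
  have hztt' : (z ^ 4) ^ (t * t) = z := by
    rw [← pow_mul, mul_comm, pow_mul, hztt]
    linear_combination z * (z ^ 10 + z ^ 5 + 1) * hz5
  have h0 : φ (φ (E 0)) = E 0 := by
    rw [hφφ]
    apply Subtype.ext
    push_cast
    rw [hE]
    simp only [he_def, Matrix.cons_val, mul_pow, hεtt, hutt]
  have h1 : φ (φ (E 1)) = E 2 := by
    rw [hφφ]
    apply Subtype.ext
    push_cast
    rw [hE, hE]
    simp only [he_def, Matrix.cons_val, mul_pow, hεtt, hztt]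
  have h2 : φ (φ (E 2)) = E 1 := by
    rw [hφφ]
    apply Subtype.ext
    push_cast
    rw [hE, hE]
    simp only [he_def, Matrix.cons_val, mul_pow, hεtt, hztt']
  let ψ : CycGal m := φ
  have hψ2 : ψ ^ 2 ≠ 1 := by
    intro h
    have h12 : E 2 = E 1 := h1.symm.trans (DFunLike.congr_fun h (E 1))
    have h12' := congrArg Subtype.val h12
    rw [hE, hE] at h12'
    simp only [he_def, Matrix.cons_val] at h12'
    refine hz.pow_ne_one_of_pos_of_lt (l := 3) (by norm_num) (by norm_num) ?_
    apply mul_left_cancel₀ (mul_ne_zero hε.isUnit.ne_zero (hz.ne_zero (by norm_num)))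
    linear_combination h12'
  have hψ4 : ψ ^ 4 = 1 := by
    refine cycField_aut_eq_one hadj hE fun i ↦ ?_
    change φ (φ (φ (φ (E i)))) = E i
    fin_cases i
    · exact (congrArg (fun x ↦ φ (φ x)) h0).trans h0
    · exact (congrArg (fun x ↦ φ (φ x)) h1).trans h2
    · exact (congrArg (fun x ↦ φ (φ x)) h2).trans h1
  have hord : orderOf (⟨ψ, hφmem⟩ : cycStabilizer m α) = 2 ^ 2 := by
    refine orderOf_eq_prime_pow (p := 2) (n := 1) ?_ ?_
    · intro h
      exact hψ2 (by simpa using congrArg Subtype.val h)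
    · exact Subtype.ext (by simpa using hψ4)
  rw [show 4 = 2 ^ 2 by norm_num, ← hord]
  exact orderOf_dvd_natCard _

theorem theorem4 (α : ℂ) (hα : IsCyclotomicInteger α) (hlen : cyclotomicLength α = 3) :
    IntermediateField.relfinrank (IntermediateField.adjoin ℚ {α})
        (cycField (cycConductor α)) ≤ 4 ∧
    (IntermediateField.relfinrank (IntermediateField.adjoin ℚ {α})
        (cycField (cycConductor α)) = 4 ↔
      ∃ (ε : ℂ) (c a : ℕ), IsOfFinOrder ε ∧ 4 ∣ orderOf ε ∧ ¬ 3 ∣ orderOf ε ∧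
        ¬ 5 ∣ orderOf ε ∧ Nat.Coprime c 6 ∧ Nat.Coprime a 5 ∧
        α = ε * (zetaRoot 6 ^ c + zetaRoot 5 ^ a + zetaRoot 5 ^ (4 * a))) := by
  have hmin : ∀ k, IsSumOfRootsOfUnity k α → 3 ≤ k := fun k hk ↦ hlen ▸ Nat.sInf_le hk
  obtain ⟨e, he, hsum⟩ : IsSumOfRootsOfUnity 3 α := hlen ▸ Nat.sInf_mem hα.2
  obtain ⟨h1, h2⟩ := relfinrank_le_four_and_form he hsum hmin
  refine ⟨h1, h2, ?_⟩
  rintro ⟨ε, c, a, hε, h4, h3, h5, hc, ha, hform⟩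
  have hd := four_dvd_relfinrank_of_form hmin hε h4 h3 h5
    ((zetaRoot_isPrimitiveRoot (by norm_num)).pow_of_coprime c hc)
    ((zetaRoot_isPrimitiveRoot (by norm_num)).pow_of_coprime a ha)
    (by rw [hform, ← pow_mul, mul_comm a 4])
  -- `relfinrank` is 0 for an infinite degree, so divisibility by 4 bounds it from below only once
  -- it is known to be nonzero.
  have hpos : relfinrank (adjoin ℚ {α}) (cycField (cycConductor α)) ≠ 0 := by
    obtain ⟨m, hm, -, hcond, -⟩ := exists_cycField_eq_adjoin he hsum hmin
    have := finite_cycField_aut hm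
    rw [hcond, relfinrank_cycField hm]
    exact Nat.card_pos.ne'
  exact le_antisymm h1 (Nat.le_of_dvd (Nat.pos_of_ne_zero hpos) hd)
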